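/- Let $n\ge 1$, $m\ge 1$, let $X$ be a set of $n$ inputs and $O$ a set of $m$ outputs. Let $\mathcal G$ be a game with rule function $\lambda: X\times X\times O\times O\to\{0,1\}$ and let $\Gamma=(\gamma_{x,y})_{x,y\in X}$ be a probability distribution on pairs of inputs: $\gamma_{x,y}\ge 0$, $\sum_{x,y}\gamma_{x,y}=1$. A projective measurement system on a Hilbert space $H$ is a family of projections $(E_{x,a})_{x\in X,a\in O}$ on $H$ with $\sum_a E_{x,a}=I$ for every $x$. Let $C_{qc}(n,m)$ be the set of all families $p(a,b|x,y)=\langle E_{x,a}F_{y,b}\psi,\psi\rangle$, where $(E_{x,a})$ and $(F_{y,b})$ are projective measurement systems on a Hilbert space $H$ with $E_{x,a}F_{y,b}=F_{y,b}E_{x,a}$ for all $x,y,a,b$, and $\psi\in H$ is a unit vector. Let $C_{loc}(n,m)$ be the subset of those $p$ that arise in this way with all the operators $E_{x,a},F_{y,b}$ commuting with each other. Let $C_q(n,m)$ be the set of all families $p(a,b|x,y)=\langle (E_{x,a}\otimes F_{y,b})\psi,\psi\rangle$, where $(E_{x,a})$ and $(F_{y,b})$ are projective measurement systems on finite dimensional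 Hilbert spaces $H_A$ and $H_B$, respectively, and $\psi\in H_A\otimes H_B$ is a unit vector. For $t\in\{loc,q,qc\}$ let $C^s_t(n,m)$ be the set of synchronous elements of $C_t(n,m)$, i.e. those with $p(a,b|x,x)=0$ for all $x$ and all $a\neq b$, and let \[ \omega^s_t(\mathcal G,\Gamma)=\sup\Big\{\sum_{x,y\in X,\;i,j\in O}\gamma_{x,y}\,\lambda(x,y,i,j)\,p(i,j|x,y)\;:\;\big(p(i,j|x,y)\big)\in C^s_t(n,m)\Big\}. \] Let $\mathbb F(n,m)$ be the free product of $n$ copies of the cyclic group $\mathbb Z_m$ of order $m$, let $C^*(\mathbb F(n,m))$ be its full group C$^*$-algebra, and let $e_{x,i}$, $i\in O$, be the minimal projections of the copy of $C^*(\mathbb Z_m)\cong\mathbb C^m$ in $C^*(\mathbb F(n,m))$ that belongs to $x\in X$. Set \[ B=\sum_{x,y\in X,\;i,j\in O}\gamma_{x,y}\,\lambda(x,y,i,j)\,e_{x,i}e_{y,j}\in C^*(\mathbb F(n,m)). \] Then $\tau(B)$ is real for every tracial state $\tau$ on $C^*(\mathbb F(n,m))$, and: 1. $\omega^s_{qc}(\mathcal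 G,\Gamma)=\sup\{\tau(B): \tau \text{ is a tracial state on } C^*(\mathbb F(n,m))\}$, and this supremum is attained. 2. $\omega^s_{q}(\mathcal G,\Gamma)=\sup\{\tau(B): \tau \text{ is a tracial state on } C^*(\mathbb F(n,m)) \text{ whose GNS representation is finite dimensional}\}$. 3. $\omega^s_{loc}(\mathcal G,\Gamma)=\sup\{\tau(B): \tau \text{ is a tracial state on } C^*(\mathbb F(n,m)) \text{ whose GNS representation has commutative image}\}$, and this supremum is attained. -/

import Mathlib

open scoped ComplexOrder TensorProduct InnerProductSpace

noncomputable section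

/-! ### The full group C⋆-algebra of a discrete group -/

/-- A unitary representation of the discrete group `G` on a complex Hilbert space. -/
structure UnitaryRep (G : Type) [Group G] where
  /-- the Hilbert space -/
  H : Type
  [normed : NormedAddCommGroup H]
  [inner : InnerProductSpace ℂ H]
  [complete : CompleteSpace H]
  /-- the action by unitaries -/
  toHom : G →* unitary (H →L[ℂ] H)

attribute [instance] UnitaryRep.normed UnitaryRep.inner UnitaryRep.complete

/-- The linear extension of a unitary representation to the group algebra `ℂ[G]`. -/
def UnitaryRep.lift {G : Type} [Group G] (ρ : UnitaryRep G) :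
    MonoidAlgebra ℂ G →ₐ[ℂ] (ρ.H →L[ℂ] ρ.H) :=
  MonoidAlgebra.lift ℂ (ρ.H →L[ℂ] ρ.H) G ((unitary (ρ.H →L[ℂ] ρ.H)).subtype.comp ρ.toHom)

/-- The group algebra `ℂ[G]`, as a type synonym that carries the involution
`(∑ c_g g)⋆ = ∑ conj(c_g) g⁻¹` and the universal C⋆-seminorm. -/
def PreGroupCStar (G : Type) [Group G] : Type := MonoidAlgebra ℂ G

namespace PreGroupCStar

variable {G : Type} [Group G]

instance : Ring (PreGroupCStar G) := inferInstanceAs (Ring (MonoidAlgebra ℂ G))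

instance : Algebra ℂ (PreGroupCStar G) := inferInstanceAs (Algebra ℂ (MonoidAlgebra ℂ G))

/-- The element `c g` of the group algebra. -/
def single (g : G) (c : ℂ) : PreGroupCStar G := MonoidAlgebra.single g c

/-- Extension of a unitary representation to the group algebra. -/
def rep (ρ : UnitaryRep G) : PreGroupCStar G →ₐ[ℂ] (ρ.H →L[ℂ] ρ.H) := ρ.lift

instance : Star (PreGroupCStar G) where
  star f := (MonoidAlgebra.coeff f).sum fun g c => single g⁻¹ (star c)

theorem induction_single {p : PreGroupCStar G → Prop} (f : PreGroupCStar G) (h0 : p 0)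
    (hadd : ∀ f g, p f → p g → p (f + g)) (hs : ∀ g c, p (single g c)) : p f :=
  MonoidAlgebra.induction_linear (motive := p) f h0 hadd hs

theorem single_mul_single (g h : G) (c d : ℂ) :
    single g c * single h d = single (g * h) (c * d) :=
  MonoidAlgebra.single_mul_single ..

theorem single_add (g : G) (c d : ℂ) : single g (c + d) = single g c + single g d :=
  MonoidAlgebra.single_add ..

theorem single_zero (g : G) : single g 0 = 0 := MonoidAlgebra.single_zero ..

theorem rep_single (ρ : UnitaryRep G) (g : G) (c : ℂ) :
    rep ρ (single g c) = c • (ρ.toHom g : ρ.H →L[ℂ] ρ.H) :=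
  MonoidAlgebra.lift_single ..

theorem star_single (g : G) (c : ℂ) : star (single g c) = single g⁻¹ (star c) := by
  change (Finsupp.single g c).sum (fun g c => single g⁻¹ (star c)) = _
  rw [Finsupp.sum_single_index]
  simp [single_zero]

theorem star_zero' : star (0 : PreGroupCStar G) = 0 :=
  Finsupp.sum_zero_index

theorem star_add' (f g : PreGroupCStar G) : star (f + g) = star f + star g := by
  change (MonoidAlgebra.coeff f + MonoidAlgebra.coeff g).sum _ = _
  rw [Finsupp.sum_add_index']
  · rfl
  · intro a; simp [single_zero]
  · intro a b c; simp [single_add]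

instance : StarRing (PreGroupCStar G) where
  star_involutive f := by
    induction f using induction_single with
    | h0 => simp [star_zero']
    | hadd f g hf hg => rw [star_add', star_add', hf, hg]
    | hs g c => simp [star_single]
  star_mul f g := by
    induction f using induction_single with
    | h0 => simp [star_zero']
    | hadd f f' hf hf' => rw [add_mul, star_add', star_add', hf, hf', mul_add]
    | hs a c =>
      induction g using induction_single with
      | h0 => simp [star_zero']
      | hadd f f' hf hf' => rw [mul_add, star_add', star_add', hf, hf', add_mul]
      | hs b d => simp [star_single, single_mul_single, mul_comm]
  star_add := star_add'

theorem smul_single (r : ℂ) (g : G) (c : ℂ) : r • single g c = single g (r * c) :=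
  MonoidAlgebra.smul_single ..

instance : StarModule ℂ (PreGroupCStar G) where
  star_smul r f := by
    induction f using induction_single with
    | h0 => simp
    | hadd f g hf hg => rw [smul_add, star_add, star_add, hf, hg, smul_add]
    | hs g c => simp [star_single, smul_single]

theorem rep_star (ρ : UnitaryRep G) (f : PreGroupCStar G) : rep ρ (star f) = star (rep ρ f) := by
  induction f using induction_single with
  | h0 => simp
  | hadd f g hf hg => rw [star_add, map_add, map_add, star_add, hf, hg]
  | hs g c =>
    rw [star_single, rep_single, rep_single, star_smul, map_inv]
    rfl

/-- The universal C⋆-seminorm `‖f‖ = sup_ρ ‖ρ(f)‖`, where `ρ` runs over all unitary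
representations of `G`. -/
def univNorm (f : PreGroupCStar G) : ℝ := ⨆ ρ : UnitaryRep G, ‖rep ρ f‖

theorem bddAbove_rep (f : PreGroupCStar G) :
    BddAbove (Set.range fun ρ : UnitaryRep G => ‖rep ρ f‖) := by
  induction f using induction_single with
  | h0 => exact ⟨0, by rintro _ ⟨ρ, rfl⟩; simp⟩
  | hadd f g hf hg =>
    obtain ⟨a, ha⟩ := hf
    obtain ⟨b, hb⟩ := hg
    refine ⟨a + b, ?_⟩
    rintro _ ⟨ρ, rfl⟩
    have h1 := ha ⟨ρ, rfl⟩
    have h2 := hb ⟨ρ, rfl⟩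
    simp only [map_add] at *
    exact (norm_add_le _ _).trans (add_le_add h1 h2)
  | hs g c =>
    refine ⟨‖c‖, ?_⟩
    rintro _ ⟨ρ, rfl⟩
    have h : ‖(ρ.toHom g : ρ.H →L[ℂ] ρ.H)‖ ≤ 1 := by
      rcases subsingleton_or_nontrivial (ρ.H →L[ℂ] ρ.H) with _ | _
      · simp [Subsingleton.elim (ρ.toHom g : ρ.H →L[ℂ] ρ.H) 0]
      · exact (CStarRing.norm_coe_unitary (ρ.toHom g)).le
    simp only [rep_single, norm_smul]
    exact mul_le_of_le_one_right (norm_nonneg c) h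

instance : Nonempty (UnitaryRep G) := ⟨{ H := ℂ, toHom := 1 }⟩

theorem rep_le (ρ : UnitaryRep G) (f : PreGroupCStar G) : ‖rep ρ f‖ ≤ univNorm f :=
  le_ciSup (bddAbove_rep f) ρ

theorem univNorm_nonneg (f : PreGroupCStar G) : 0 ≤ univNorm f :=
  Real.iSup_nonneg fun _ => norm_nonneg _

/-- The universal C⋆-seminorm as a ring seminorm. -/
def univSeminorm (G : Type) [Group G] : RingSeminorm (PreGroupCStar G) where
  toFun := univNorm
  map_zero' := by simp [univNorm]
  add_le' f g := ciSup_le fun ρ => by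
    rw [map_add]
    exact (norm_add_le _ _).trans (add_le_add (rep_le ρ f) (rep_le ρ g))
  neg' f := by simp [univNorm]
  mul_le' f g := ciSup_le fun ρ => by
    rw [map_mul]
    exact (norm_mul_le _ _).trans
      (mul_le_mul (rep_le ρ f) (rep_le ρ g) (norm_nonneg _) (univNorm_nonneg f))

instance : SeminormedRing (PreGroupCStar G) := (univSeminorm G).toSeminormedRing

theorem norm_def (f : PreGroupCStar G) : ‖f‖ = ⨆ ρ : UnitaryRep G, ‖rep ρ f‖ := rfl

instance : NormedAlgebra ℂ (PreGroupCStar G) where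
  norm_smul_le r f := ciSup_le fun ρ => by
    rw [map_smul, norm_smul]
    exact mul_le_mul_of_nonneg_left (rep_le ρ f) (norm_nonneg r)

theorem norm_star' (f : PreGroupCStar G) : ‖star f‖ = ‖f‖ := by
  simp [norm_def, rep_star]

theorem norm_mul_self_le (f : PreGroupCStar G) : ‖f‖ * ‖f‖ ≤ ‖star f * f‖ := by
  have h : ‖f‖ ≤ √‖star f * f‖ := ciSup_le fun ρ => by
    apply Real.le_sqrt_of_sq_le
    rw [sq, ← CStarRing.norm_star_mul_self, ← rep_star, ← map_mul]
    exact rep_le ρ _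
  calc ‖f‖ * ‖f‖ ≤ √‖star f * f‖ * √‖star f * f‖ :=
        mul_le_mul h h (norm_nonneg _) (Real.sqrt_nonneg _)
    _ = _ := Real.mul_self_sqrt (norm_nonneg _)

instance : NormedStarGroup (PreGroupCStar G) where
  norm_star_le f := (norm_star' f).le

end PreGroupCStar

/-- The full group C⋆-algebra `C⋆(G)` of a discrete group `G`: the (Hausdorff) completion of the
group algebra `ℂ[G]` in the universal C⋆-seminorm. -/
def GroupCStar (G : Type) [Group G] : Type := UniformSpace.Completion (PreGroupCStar G)

namespace GroupCStar

open UniformSpace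

variable {G : Type} [Group G]

instance : NormedRing (GroupCStar G) :=
  inferInstanceAs (NormedRing (Completion (PreGroupCStar G)))

instance : CompleteSpace (GroupCStar G) :=
  inferInstanceAs (CompleteSpace (Completion (PreGroupCStar G)))

instance : Algebra ℂ (GroupCStar G) :=
  inferInstanceAs (Algebra ℂ (Completion (PreGroupCStar G)))

instance : NormedAlgebra ℂ (GroupCStar G) where
  norm_smul_le r f := norm_smul_le (β := Completion (PreGroupCStar G)) r f

/-- The canonical map `ℂ[G] → C⋆(G)`. -/
def coe (f : PreGroupCStar G) : GroupCStar G := (f : Completion (PreGroupCStar G))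

theorem continuous_coe : Continuous (coe : PreGroupCStar G → GroupCStar G) :=
  Completion.continuous_coe _

theorem coe_add (f g : PreGroupCStar G) : coe (f + g) = coe f + coe g := Completion.coe_add f g

theorem coe_mul (f g : PreGroupCStar G) : coe (f * g) = coe f * coe g := Completion.coe_mul f g

theorem coe_smul (r : ℂ) (f : PreGroupCStar G) : coe (r • f) = r • coe f := Completion.coe_smul r f

theorem norm_coe (f : PreGroupCStar G) : ‖coe f‖ = ‖f‖ := Completion.norm_coe f

theorem induction_coe {p : GroupCStar G → Prop} (a : GroupCStar G) (hp : IsClosed {a | p a})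
    (ih : ∀ f : PreGroupCStar G, p (coe f)) : p a :=
  Completion.induction_on a hp ih

/-- The involution of `C⋆(G)` is the continuous extension of that of the group algebra. -/
instance : Star (GroupCStar G) where
  star := Completion.map (star : PreGroupCStar G → PreGroupCStar G)

theorem continuous_star' : Continuous (star : GroupCStar G → GroupCStar G) :=
  Completion.continuous_map

theorem star_coe (f : PreGroupCStar G) : star (coe f) = coe (star f) :=
  Completion.map_coe star_isometry.uniformContinuous f

instance : StarRing (GroupCStar G) where
  star_involutive a := by
    induction a using induction_coe with
    | hp => exact isClosed_eq (continuous_star'.comp continuous_star') continuous_id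
    | ih f => simp [star_coe]
  star_mul a b := by
    induction a using induction_coe with
    | hp =>
      exact isClosed_eq (continuous_star'.comp (continuous_id.mul continuous_const))
        (continuous_const.mul continuous_star')
    | ih f =>
      induction b using induction_coe with
      | hp =>
        exact isClosed_eq (continuous_star'.comp (continuous_const.mul continuous_id))
          (continuous_star'.mul continuous_const)
      | ih g => simp [star_coe, ← coe_mul]
  star_add a b := by
    induction a using induction_coe with
    | hp =>
      exact isClosed_eq (continuous_star'.comp (continuous_id.add continuous_const))
        (continuous_star'.add continuous_const)
    | ih f =>
      induction b using induction_coe with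
      | hp =>
        exact isClosed_eq (continuous_star'.comp (continuous_const.add continuous_id))
          (continuous_const.add continuous_star')
      | ih g => simp [star_coe, ← coe_add]

instance : StarModule ℂ (GroupCStar G) where
  star_smul r a := by
    induction a using induction_coe with
    | hp =>
      exact isClosed_eq (continuous_star'.comp (continuous_id.const_smul r))
        (continuous_star'.const_smul (star r))
    | ih f => simp [star_coe, ← coe_smul]

instance : CStarRing (GroupCStar G) where
  norm_mul_self_le a := by
    induction a using induction_coe with
    | hp =>
      exact isClosed_le (continuous_norm.mul continuous_norm)
        (continuous_norm.comp (continuous_star'.mul continuous_id))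
    | ih f =>
      rw [star_coe, ← coe_mul, norm_coe, norm_coe]
      exact PreGroupCStar.norm_mul_self_le f

instance : CStarAlgebra (GroupCStar G) where

/-- The usual order of a C⋆-algebra: `a ≤ b` iff `b - a` is a positive element. -/
instance : PartialOrder (GroupCStar G) := CStarAlgebra.spectralOrder _

instance : StarOrderedRing (GroupCStar G) := CStarAlgebra.spectralOrderedRing _

/-- The canonical unitary `u_g ∈ C⋆(G)` of a group element `g`. -/
def u (g : G) : GroupCStar G := coe (PreGroupCStar.single g 1)

end GroupCStar

/-! ### Tracial states and their GNS representations -/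

section Traces

variable {A : Type*} [CStarAlgebra A] [PartialOrder A] [StarOrderedRing A]

/-- A positive linear functional `τ` is a tracial state if `τ(1) = 1` and `τ(ab) = τ(ba)`. -/
structure IsTracialState (τ : A →ₚ[ℂ] ℂ) : Prop where
  map_one : τ 1 = 1
  map_mul_comm : ∀ a b : A, τ (a * b) = τ (b * a)

/-- The GNS representation of `τ` is finite dimensional: it acts on a finite dimensional
Hilbert space. -/
def HasFiniteDimensionalGNS (τ : A →ₚ[ℂ] ℂ) : Prop :=
  FiniteDimensional ℂ τ.GNS

/-- The GNS representation of `τ` is abelian: its image is a commutative algebra of operators. -/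
def HasAbelianGNS (τ : A →ₚ[ℂ] ℂ) : Prop :=
  ∀ a b : A, Commute (τ.gnsStarAlgHom a) (τ.gnsStarAlgHom b)

end Traces

/-! ### The C⋆-algebra of the free product of cyclic groups -/

/-- `𝔽(n,m)`: the free product of `n` copies of the cyclic group of order `m`. -/
abbrev FreeProdCyclic (n m : ℕ) : Type :=
  Monoid.CoprodI fun _ : Fin n => Multiplicative (ZMod m)

/-- The element `e_{x,i}` of `C⋆(𝔽(n,m))`: the `i`-th minimal projection of the `x`-th copy of
`C⋆(ℤ/m) ≅ ℂ^m`. If `u` is the unitary of the generator of the `x`-th copy of `ℤ/m`, it is the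
spectral projection `m⁻¹ ∑_{k ∈ ℤ/m} exp(-2πi·ik/m) u^k` of `u` for the eigenvalue
`exp(2πi·i/m)`. -/
def minProj {n m : ℕ} [NeZero m] (x : Fin n) (i : Fin m) : GroupCStar (FreeProdCyclic n m) :=
  (m : ℂ)⁻¹ • ∑ k : ZMod m, ZMod.stdAddChar (-(((i : ℕ) : ZMod m) * k)) •
    GroupCStar.u (Monoid.CoprodI.of (M := fun _ : Fin n => Multiplicative (ZMod m)) (i := x)
      (Multiplicative.ofAdd k))

/-! ### Correlations -/

/-- A family `p(a,b|x,y)`, written `p x y a b`, indexed by inputs `x, y` and outputs `a, b`. -/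
abbrev Correlation (n m : ℕ) : Type := Fin n → Fin n → Fin m → Fin m → ℝ

/-- For every input `x`, the `E_{x,a}` are (orthogonal) projections with `∑_a E_{x,a} = 1`. -/
def IsProjectiveMeasurement {n m : ℕ} {H : Type} [NormedAddCommGroup H] [InnerProductSpace ℂ H]
    [CompleteSpace H] (E : Fin n → Fin m → (H →L[ℂ] H)) : Prop :=
  (∀ x a, IsStarProjection (E x a)) ∧ ∀ x, ∑ a, E x a = 1

/-- Commuting quantum correlations `C_qc(n,m)`. (Mathlib's inner product is linear in the second
variable.) -/
def Cqc (n m : ℕ) : Set (Correlation n m) :=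
  {p | ∃ (H : Type) (_ : NormedAddCommGroup H) (_ : InnerProductSpace ℂ H) (_ : CompleteSpace H)
    (E F : Fin n → Fin m → (H →L[ℂ] H)) (ψ : H),
    IsProjectiveMeasurement E ∧ IsProjectiveMeasurement F ∧
    (∀ x y a b, Commute (E x a) (F y b)) ∧ ‖ψ‖ = 1 ∧
    ∀ x y a b, (p x y a b : ℂ) = ⟪ψ, (E x a * F y b) ψ⟫_ℂ}

/-- Quantum correlations `C_q(n,m)`: tensor products of finite dimensional Hilbert spaces. -/
def Cq (n m : ℕ) : Set (Correlation n m) :=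
  {p | ∃ (HA : Type) (_ : NormedAddCommGroup HA) (_ : InnerProductSpace ℂ HA)
    (_ : CompleteSpace HA) (_ : FiniteDimensional ℂ HA)
    (HB : Type) (_ : NormedAddCommGroup HB) (_ : InnerProductSpace ℂ HB)
    (_ : CompleteSpace HB) (_ : FiniteDimensional ℂ HB)
    (E : Fin n → Fin m → (HA →L[ℂ] HA)) (F : Fin n → Fin m → (HB →L[ℂ] HB))
    (ψ : HA ⊗[ℂ] HB),
    IsProjectiveMeasurement E ∧ IsProjectiveMeasurement F ∧ ‖ψ‖ = 1 ∧
    ∀ x y a b, (p x y a b : ℂ) =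
      ⟪ψ, TensorProduct.map (E x a : HA →ₗ[ℂ] HA) (F y b : HB →ₗ[ℂ] HB) ψ⟫_ℂ}

/-- Local (classical) correlations `C_loc(n,m)`: commuting quantum strategies for which all the
measurement operators commute. -/
def Cloc (n m : ℕ) : Set (Correlation n m) :=
  {p | ∃ (H : Type) (_ : NormedAddCommGroup H) (_ : InnerProductSpace ℂ H) (_ : CompleteSpace H)
    (E F : Fin n → Fin m → (H →L[ℂ] H)) (ψ : H),
    IsProjectiveMeasurement E ∧ IsProjectiveMeasurement F ∧
    (∀ x y a b, Commute (E x a) (F y b)) ∧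
    (∀ x y a b, Commute (E x a) (E y b)) ∧ (∀ x y a b, Commute (F x a) (F y b)) ∧ ‖ψ‖ = 1 ∧
    ∀ x y a b, (p x y a b : ℂ) = ⟪ψ, (E x a * F y b) ψ⟫_ℂ}

/-- Synchronous families: `p(a,b|x,x) = 0` for `a ≠ b`. -/
def synchronous (n m : ℕ) : Set (Correlation n m) :=
  {p | ∀ x a b, a ≠ b → p x x a b = 0}

/-! ### Games and values -/

/-- A game with inputs `Fin n` and outputs `Fin m`; `rule x y a b = false` means that the
outputs `a, b` are disallowed on the inputs `x, y`. -/
structure Game (n m : ℕ) where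
  /-- the rule function `λ` -/
  rule : Fin n → Fin n → Fin m → Fin m → Bool

/-- The rule function as a `{0,1}`-valued real function. -/
def Game.lam {n m : ℕ} (G : Game n m) (x y : Fin n) (a b : Fin m) : ℝ :=
  if G.rule x y a b then 1 else 0

/-- A probability distribution on pairs of inputs. -/
structure InputDistribution (n : ℕ) where
  /-- the probabilities `γ_{x,y}` -/
  γ : Fin n → Fin n → ℝ
  nonneg : ∀ x y, 0 ≤ γ x y
  sum_eq_one : ∑ x, ∑ y, γ x y = 1

/-- The expected payoff `∑ γ_{x,y} λ(x,y,i,j) p(i,j|x,y)` of a correlation. -/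
def payoff {n m : ℕ} (G : Game n m) (Γ : InputDistribution n) (p : Correlation n m) : ℝ :=
  ∑ x, ∑ y, ∑ i, ∑ j, Γ.γ x y * G.lam x y i j * p x y i j

/-- The synchronous value of the game for the family `C` of correlations: the supremum of the
payoff over the synchronous elements of `C`. -/
def syncValue {n m : ℕ} (C : Set (Correlation n m)) (G : Game n m) (Γ : InputDistribution n) : ℝ :=
  sSup (payoff G Γ '' (C ∩ synchronous n m))

/-- The element `B = ∑ γ_{x,y} λ(x,y,i,j) e_{x,i} e_{y,j}` of `C⋆(𝔽(n,m))`. -/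
def gameElement {n m : ℕ} [NeZero m] (G : Game n m) (Γ : InputDistribution n) :
    GroupCStar (FreeProdCyclic n m) :=
  ∑ x, ∑ y, ∑ i, ∑ j, ((Γ.γ x y * G.lam x y i j : ℝ) : ℂ) • (minProj x i * minProj y j)

end

/-!
The synchronous commuting correlations are exactly `p(i, j | x, y) = τ(e_{x,i} e_{y,j})` for tracial
states `τ`. If `p` is given by `E`, `F`, `ψ`, synchronicity forces `E_{x,i} ψ = F_{x,i} ψ`, so that
on `ψ` the representation `e_{x,i} ↦ E_{x,i}` can be traded for operators in its commutant, and the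
vector state of `ψ` is a trace. Conversely, on the GNS space of a trace both left and right
multiplication act, and they commute.

For a finite dimensional GNS space right multiplication has to be moved to a second tensor factor.
For an orthonormal basis `a_k` of that space, `∑ a_k a_k⋆` acts as a central positive operator, and
dividing `∑ a_k ⊗ a_k⋆` by its square root yields a vector of GNS ⊗ GNS that implements `τ`.

Suprema over compact sets are attained, and the conditions defining tracial states, possibly with
commutative GNS representation, are weak-⋆ closed. A finite dimensional GNS space is not a closed
condition.
-/

noncomputable section

/-! ### The universal property of the group C⋆-algebra -/

namespace GroupCStar

open UniformSpace

variable {G : Type} [Group G]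

/-- The canonical unitaries as a monoid homomorphism `G → C⋆(G)`. -/
def uHom (G : Type) [Group G] : G →* GroupCStar G where
  toFun := u
  map_one' := rfl
  map_mul' g h := by simp [u, ← coe_mul, PreGroupCStar.single_mul_single]

theorem star_uHom (g : G) : star (uHom G g) = uHom G g⁻¹ := by
  change star (u g) = u g⁻¹
  simp [u, star_coe, PreGroupCStar.star_single]

theorem continuous_rep (ρ : UnitaryRep G) : Continuous (PreGroupCStar.rep ρ).toRingHom :=
  AddMonoidHomClass.continuous_of_bound (PreGroupCStar.rep ρ).toRingHom 1 fun f => by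
    rw [one_mul]
    exact PreGroupCStar.rep_le ρ f

/-- The extension of a unitary representation of `G` to a representation of `C⋆(G)`. -/
def extend (ρ : UnitaryRep G) : GroupCStar G →⋆ₐ[ℂ] (ρ.H →L[ℂ] ρ.H) where
  toRingHom := Completion.extensionHom (PreGroupCStar.rep ρ).toRingHom (continuous_rep ρ)
  commutes' c :=
    (Completion.extensionHom_coe _ (continuous_rep ρ) _).trans ((PreGroupCStar.rep ρ).commutes c)
  map_star' a := by
    let ext : GroupCStar G → (ρ.H →L[ℂ] ρ.H) := Completion.extension (PreGroupCStar.rep ρ).toRingHom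
    have continuous_ext : Continuous ext := Completion.continuous_extension
    have ext_coe (f) : ext (coe f) = PreGroupCStar.rep ρ f :=
      Completion.extensionHom_coe _ (continuous_rep ρ) f
    change ext (star a) = star (ext a)
    induction a using induction_coe with
    | hp =>
      exact isClosed_eq (continuous_ext.comp continuous_star') (continuous_star.comp continuous_ext)
    | ih f => rw [star_coe, ext_coe, ext_coe, PreGroupCStar.rep_star]

theorem extend_uHom (ρ : UnitaryRep G) (g : G) : extend ρ (uHom G g) = ρ.toHom g := by
  have h : extend ρ (uHom G g) = PreGroupCStar.rep ρ (PreGroupCStar.single g 1) :=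
    Completion.extensionHom_coe _ (continuous_rep ρ) _
  rw [h, PreGroupCStar.rep_single, one_smul]

theorem eq_top_of_uHom_mem {S : Subalgebra ℂ (GroupCStar G)}
    (hS : IsClosed (S : Set (GroupCStar G))) (hu : ∀ g, uHom G g ∈ S) : S = ⊤ := by
  refine Algebra.eq_top_iff.2 fun a => ?_
  induction a using induction_coe with
  | hp => exact hS
  | ih f =>
    induction f using PreGroupCStar.induction_single with
    | h0 => exact S.zero_mem
    | hadd f g hf hg =>
      rw [coe_add]
      exact S.add_mem hf hg
    | hs g c =>
      rw [← mul_one c, ← PreGroupCStar.smul_single, coe_smul]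
      exact S.smul_mem (hu g) c

end GroupCStar

/-! ### Projection partitions and representations of cyclic groups -/

/-- A finite family of projections of a star algebra with sum `1` (a projection valued measure on
a finite set). -/
structure IsProjectionPartition {ι A : Type*} [Fintype ι] [NonAssocSemiring A] [Star A]
    (e : ι → A) : Prop where
  isStarProjection : ∀ i, IsStarProjection (e i)
  sum_eq_one : ∑ i, e i = 1

namespace IsProjectionPartition

variable {ι κ A B : Type*} [Fintype ι] [Fintype κ]

theorem comp_equiv [NonAssocSemiring A] [Star A] {e : ι → A} (he : IsProjectionPartition e)
    (σ : κ ≃ ι) : IsProjectionPartition (e ∘ σ) :=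
  ⟨fun k => he.isStarProjection (σ k), (σ.sum_comp e).trans he.sum_eq_one⟩

theorem map [Semiring A] [Algebra ℂ A] [Star A] [Semiring B] [Algebra ℂ B] [Star B] {e : ι → A}
    (he : IsProjectionPartition e) (φ : A →⋆ₐ[ℂ] B) : IsProjectionPartition fun i => φ (e i) :=
  ⟨fun i => (he.isStarProjection i).map φ, by rw [← map_sum, he.sum_eq_one, map_one]⟩

theorem op [Semiring A] [StarRing A] {e : ι → A} (he : IsProjectionPartition e) :
    IsProjectionPartition fun i => MulOpposite.op (e i) where
  isStarProjection i :=
    ⟨congrArg MulOpposite.op (he.isStarProjection i).isIdempotentElem,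
      congrArg MulOpposite.op (he.isStarProjection i).isSelfAdjoint⟩
  sum_eq_one := by rw [← Finset.op_sum, he.sum_eq_one, MulOpposite.op_one]

theorem mul_eq_zero [NormedRing A] [StarRing A] [CStarRing A] [PartialOrder A] [StarOrderedRing A]
    {e : ι → A} (he : IsProjectionPartition e) {i j : ι} (hij : i ≠ j) : e i * e j = 0 := by
  classical
  have star_mul_self (k) : star (e k * e j) * (e k * e j) = e j * e k * e j := by
    rw [star_mul, (he.isStarProjection k).isSelfAdjoint, (he.isStarProjection j).isSelfAdjoint,
      mul_assoc, ← mul_assoc (e k), (he.isStarProjection k).isIdempotentElem, mul_assoc]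
  have sum_eq : ∑ k, star (e k * e j) * (e k * e j) = e j := by
    simp only [star_mul_self, ← Finset.mul_sum, ← Finset.sum_mul, he.sum_eq_one, mul_one,
      (he.isStarProjection j).isIdempotentElem.eq]
  rw [← Finset.add_sum_erase _ _ (Finset.mem_univ j), star_mul_self,
    (he.isStarProjection j).isIdempotentElem.eq, (he.isStarProjection j).isIdempotentElem.eq,
    add_eq_left, Finset.sum_eq_zero_iff_of_nonneg fun k _ => star_mul_self_nonneg _] at sum_eq
  exact CStarRing.star_mul_self_eq_zero_iff _ |>.1
    (sum_eq i (Finset.mem_erase.2 ⟨hij, Finset.mem_univ i⟩))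

end IsProjectionPartition

theorem star_stdAddChar {m : ℕ} [NeZero m] (k : ZMod m) :
    star (ZMod.stdAddChar k) = ZMod.stdAddChar (-k) := by
  have hm : 0 < ringChar (ZMod m) := by
    rw [ZMod.ringChar_zmod_n]
    exact NeZero.pos m
  exact (AddChar.starComp_apply hm k).trans (AddChar.inv_apply _ _)

section SpectralProjections

variable {m : ℕ} [NeZero m] {A B : Type*}

/-- The spectral projection of a representation `U` of `ℤ/m` for the character
`k ↦ exp(2πi·ck/m)`: the `c`-th Fourier coefficient of `U`. -/
def spectralProj [Ring A] [Algebra ℂ A] (U : AddChar (ZMod m) A) (c : ZMod m) : A :=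
  (m : ℂ)⁻¹ • ZMod.dft U c

variable [Ring A] [Algebra ℂ A] [Ring B] [Algebra ℂ B]

theorem map_spectralProj (φ : A →ₐ[ℂ] B) (U : AddChar (ZMod m) A) (c : ZMod m) :
    φ (spectralProj U c) = spectralProj ((φ : A →* B).compAddChar U) c := by
  simp [spectralProj, ZMod.dft_apply]

theorem spectralProj_mul_apply (U : AddChar (ZMod m) A) (c l : ZMod m) :
    spectralProj U c * U l = ZMod.stdAddChar (c * l) • spectralProj U c := by
  simp only [spectralProj, ZMod.dft_apply, smul_mul_assoc, Finset.sum_mul,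
    ← AddChar.map_add_eq_mul, Finset.smul_sum, smul_smul]
  refine Fintype.sum_equiv (Equiv.addRight l) _ _ fun k => ?_
  rw [Equiv.coe_addRight, mul_left_comm, ← AddChar.map_add_eq_mul]
  ring_nf

theorem sum_smul_spectralProj (U : AddChar (ZMod m) A) (k : ZMod m) :
    ∑ c, ZMod.stdAddChar (c * k) • spectralProj U c = U k := by
  conv_rhs => rw [← ZMod.dft.symm_apply_apply ⇑U, ZMod.invDFT_apply]
  simp only [spectralProj, Finset.smul_sum, smul_comm (m : ℂ)⁻¹]

theorem isIdempotentElem_spectralProj (U : AddChar (ZMod m) A) (c : ZMod m) :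
    IsIdempotentElem (spectralProj U c) := by
  have hm : (m : ℂ) ≠ 0 := NeZero.ne _
  have smul_mul_apply (k : ZMod m) :
      ZMod.stdAddChar (-(k * c)) • (spectralProj U c * U k) = spectralProj U c := by
    rw [spectralProj_mul_apply, smul_smul, ← AddChar.map_add_eq_mul, mul_comm, neg_add_cancel,
      AddChar.map_zero_eq_one, one_smul]
  calc spectralProj U c * spectralProj U c
      = (m : ℂ)⁻¹ • ∑ k, ZMod.stdAddChar (-(k * c)) • (spectralProj U c * U k) := by
        conv_lhs => rhs; rw [spectralProj, ZMod.dft_apply]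
        simp only [mul_smul_comm, Finset.mul_sum]
    _ = spectralProj U c := by
        simp only [smul_mul_apply, Finset.sum_const, Finset.card_univ, ZMod.card,
          ← Nat.cast_smul_eq_nsmul ℂ, inv_smul_smul₀ hm]

variable [StarRing A] [StarModule ℂ A]

theorem isProjectionPartition_spectralProj {U : AddChar (ZMod m) A}
    (hU : ∀ k, star (U k) = U (-k)) : IsProjectionPartition (spectralProj U) where
  isStarProjection c := by
    refine ⟨isIdempotentElem_spectralProj U c, ?_⟩
    simp only [IsSelfAdjoint, spectralProj, ZMod.dft_apply, star_smul, star_sum, star_inv₀,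
      star_natCast, star_stdAddChar, hU]
    congr 1
    exact Fintype.sum_equiv (Equiv.neg (ZMod m)) _ _ fun k => by simp
  sum_eq_one := by simpa using sum_smul_spectralProj U 0

end SpectralProjections

namespace IsProjectionPartition

variable {m : ℕ} [NeZero m] {A : Type*} [NormedRing A] [Algebra ℂ A] [StarRing A] [CStarRing A]
  [PartialOrder A] [StarOrderedRing A] {e : ZMod m → A}

/-- The representation `k ↦ ∑_c exp(2πi·ck/m) e_c` of `ℤ/m` whose spectral projections are the
given projections `e_c`. -/
def addChar (he : IsProjectionPartition e) : AddChar (ZMod m) A where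
  toFun k := ∑ c, ZMod.stdAddChar (c * k) • e c
  map_zero_eq_one' := by simpa using he.sum_eq_one
  map_add_eq_mul' k l := by
    simp only [Finset.sum_mul_sum, smul_mul_smul_comm]
    refine Finset.sum_congr rfl fun c _ => ?_
    rw [Finset.sum_eq_single_of_mem c (Finset.mem_univ c), (he.isStarProjection c).isIdempotentElem,
      ← AddChar.map_add_eq_mul, mul_add]
    intro d _ hd
    rw [he.mul_eq_zero hd.symm, smul_zero]

theorem addChar_apply (he : IsProjectionPartition e) (k : ZMod m) :
    he.addChar k = ∑ c, ZMod.stdAddChar (c * k) • e c := rfl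

theorem spectralProj_addChar (he : IsProjectionPartition e) : spectralProj he.addChar = e := by
  have hm : (m : ℂ) ≠ 0 := NeZero.ne _
  have : ⇑he.addChar = (m : ℂ) • ZMod.dft.symm e := by
    ext k
    simp [addChar_apply, ZMod.invDFT_apply, hm]
  ext c
  simp [spectralProj, this, hm]

theorem star_addChar [StarModule ℂ A] (he : IsProjectionPartition e) (k : ZMod m) :
    star (he.addChar k) = he.addChar (-k) := by
  simp [addChar_apply, star_sum, star_stdAddChar, (he.isStarProjection _).isSelfAdjoint.star_eq]

/-- `IsProjectionPartition.addChar` as a unitary representation. -/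
def unitaryHom [StarModule ℂ A] (he : IsProjectionPartition e) :
    Multiplicative (ZMod m) →* unitary A :=
  he.addChar.toMonoidHom.codRestrict (unitary A) fun k => by
    simp [Unitary.mem_iff, star_addChar, ← AddChar.map_add_eq_mul]

end IsProjectionPartition

/-! ### The projections `e_{x,i}` -/

section MinProj

variable {n m : ℕ} {H : Type} [NormedAddCommGroup H] [InnerProductSpace ℂ H] [CompleteSpace H]

theorem isProjectiveMeasurement_iff {E : Fin n → Fin m → (H →L[ℂ] H)} :
    IsProjectiveMeasurement E ↔ ∀ x, IsProjectionPartition (E x) :=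
  ⟨fun hE x => ⟨hE.1 x, hE.2 x⟩,
    fun hE => ⟨fun x => (hE x).isStarProjection, fun x => (hE x).sum_eq_one⟩⟩

/-- The unitary representation of the `x`-th copy of `ℤ/m` in `C⋆(𝔽(n,m))`. -/
def factorChar (x : Fin n) : AddChar (ZMod m) (GroupCStar (FreeProdCyclic n m)) :=
  AddChar.toMonoidHomEquiv.symm <| (GroupCStar.uHom _).comp <|
    Monoid.CoprodI.of (M := fun _ : Fin n => Multiplicative (ZMod m)) (i := x)

theorem star_factorChar (x : Fin n) (k : ZMod m) :
    star (factorChar x k) = factorChar x (-k) := by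
  simp [factorChar, GroupCStar.star_uHom]

variable [NeZero m]

theorem finEquiv_eq_natCast (i : Fin m) : ZMod.finEquiv m i = ((i : ℕ) : ZMod m) := by
  cases m with
  | zero => exact i.elim0
  | succ k => exact (ZMod.natCast_zmod_val (n := k + 1) i).symm

theorem minProj_eq_spectralProj (x : Fin n) (i : Fin m) :
    minProj x i = spectralProj (factorChar x) (ZMod.finEquiv m i) := by
  simp only [minProj, spectralProj, ZMod.dft_apply, finEquiv_eq_natCast, mul_comm]
  rfl

theorem isProjectionPartition_minProj (x : Fin n) :
    IsProjectionPartition fun i : Fin m => minProj x i := by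
  simp only [minProj_eq_spectralProj]
  exact (isProjectionPartition_spectralProj (star_factorChar x)).comp_equiv
    (ZMod.finEquiv m).toEquiv

theorem eq_top_of_minProj_mem {S : Subalgebra ℂ (GroupCStar (FreeProdCyclic n m))}
    (hS : IsClosed (S : Set (GroupCStar (FreeProdCyclic n m)))) (he : ∀ x i, minProj x i ∈ S) :
    S = ⊤ := by
  refine GroupCStar.eq_top_of_uHom_mem hS fun g => ?_
  induction g using Monoid.CoprodI.induction_on with
  | one => exact S.one_mem
  | mul g h hg hh =>
    rw [map_mul]
    exact S.mul_mem hg hh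
  | of x k =>
    change factorChar x k.toAdd ∈ S
    rw [← sum_smul_spectralProj]
    refine S.sum_mem fun c _ => S.smul_mem ?_ _
    simpa [minProj_eq_spectralProj] using he x ((ZMod.finEquiv m).symm c)

theorem IsProjectiveMeasurement.exists_starAlgHom {E : Fin n → Fin m → (H →L[ℂ] H)}
    (hE : IsProjectiveMeasurement E) :
    ∃ π : GroupCStar (FreeProdCyclic n m) →⋆ₐ[ℂ] (H →L[ℂ] H), ∀ x i, π (minProj x i) = E x i := by
  have hE' (x) := (isProjectiveMeasurement_iff.1 hE x).comp_equiv (ZMod.finEquiv m).symm.toEquiv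
  let ρ : UnitaryRep (FreeProdCyclic n m) :=
    { H := H, toHom := Monoid.CoprodI.lift fun x => (hE' x).unitaryHom }
  have extend_factorChar (x) : ((GroupCStar.extend ρ).toAlgHom : _ →* _).compAddChar
      (factorChar x) = (hE' x).addChar := by
    ext1 k
    change GroupCStar.extend ρ (GroupCStar.uHom _ (Monoid.CoprodI.of (Multiplicative.ofAdd k))) = _
    rw [GroupCStar.extend_uHom, Monoid.CoprodI.lift_of]
    rfl
  refine ⟨GroupCStar.extend ρ, fun x i => ?_⟩
  calc GroupCStar.extend ρ (minProj x i)
      = spectralProj (hE' x).addChar (ZMod.finEquiv m i) := by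
        rw [minProj_eq_spectralProj, ← extend_factorChar, ← map_spectralProj]
        rfl
    _ = E x i := by simp [(hE' x).spectralProj_addChar]

end MinProj

/-! ### The GNS representation of a tracial state -/

section GNS

open UniformSpace

variable {A : Type*} [CStarAlgebra A] [PartialOrder A] [StarOrderedRing A]

/-- The canonical linear map of a C⋆-algebra into the GNS space of a positive functional. -/
def toGNS (τ : A →ₚ[ℂ] ℂ) : A →ₗ[ℂ] τ.GNS :=
  Completion.toComplL.toLinearMap ∘ₗ τ.toPreGNS.toLinearMap

variable {τ : A →ₚ[ℂ] ℂ}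

theorem denseRange_toGNS : DenseRange (toGNS τ) :=
  Completion.denseRange_coe (α := τ.PreGNS)

theorem continuousLinearMap_ext_toGNS {S T : τ.GNS →L[ℂ] τ.GNS}
    (h : ∀ a, S (toGNS τ a) = T (toGNS τ a)) : S = T :=
  DFunLike.coe_injective (denseRange_toGNS.equalizer S.continuous T.continuous (funext h))

theorem inner_toGNS (a b : A) : ⟪toGNS τ a, toGNS τ b⟫_ℂ = τ (star a * b) :=
  Completion.inner_coe _ _

theorem norm_toGNS_sq (a : A) : ((‖toGNS τ a‖ ^ 2 : ℝ) : ℂ) = τ (star a * a) := by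
  rw [← inner_toGNS, inner_self_eq_norm_sq_to_K, RCLike.ofReal_eq_complex_ofReal,
    Complex.ofReal_pow]

theorem gnsStarAlgHom_toGNS (a b : A) : τ.gnsStarAlgHom a (toGNS τ b) = toGNS τ (a * b) :=
  PositiveLinearMap.gnsNonUnitalStarAlgHom_apply_coe τ

theorem apply_eq_inner_gns (a : A) : τ a = ⟪toGNS τ 1, τ.gnsStarAlgHom a (toGNS τ 1)⟫_ℂ := by
  rw [gnsStarAlgHom_toGNS, inner_toGNS, star_one, one_mul, mul_one]

theorem norm_gnsStarAlgHom_apply_le (a : A) (v : τ.GNS) : ‖τ.gnsStarAlgHom a v‖ ≤ ‖a‖ * ‖v‖ :=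
  (τ.gnsStarAlgHom a).le_of_opNorm_le (NonUnitalStarAlgHom.norm_apply_le τ.gnsStarAlgHom a) v

theorem norm_toGNS_one (hτ : τ 1 = 1) : ‖toGNS τ 1‖ = 1 := by
  have h : ((‖toGNS τ 1‖ ^ 2 : ℝ) : ℂ) = 1 := by rw [norm_toGNS_sq, star_one, one_mul, hτ]
  exact (pow_eq_one_iff_of_nonneg (norm_nonneg _) two_ne_zero).1 (mod_cast h)

theorem norm_apply_le_of_map_one (hτ : τ 1 = 1) (a : A) : ‖τ a‖ ≤ ‖a‖ :=
  calc ‖τ a‖ ≤ ‖toGNS τ 1‖ * ‖τ.gnsStarAlgHom a (toGNS τ 1)‖ := by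
        rw [apply_eq_inner_gns]
        exact norm_inner_le_norm _ _
    _ ≤ ‖a‖ := by simpa [norm_toGNS_one hτ] using norm_gnsStarAlgHom_apply_le a (toGNS τ 1)

theorem hasAbelianGNS_iff :
    HasAbelianGNS τ ↔ ∀ a b c d : A, τ (star c * ((a * b - b * a) * d)) = 0 := by
  have inner_commutator (a b c d) : τ (star c * ((a * b - b * a) * d)) =
      ⟪toGNS τ c, (τ.gnsStarAlgHom a * τ.gnsStarAlgHom b -
        τ.gnsStarAlgHom b * τ.gnsStarAlgHom a) (toGNS τ d)⟫_ℂ := by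
    rw [← inner_toGNS, ← gnsStarAlgHom_toGNS, map_sub, map_mul, map_mul]
  refine ⟨fun h a b c d => ?_, fun h a b => sub_eq_zero.1 <| continuousLinearMap_ext_toGNS fun d =>
    ext_inner_left ℂ fun v => ?_⟩
  · rw [inner_commutator, (h a b).eq, sub_self, zero_apply, inner_zero_right]
  · refine denseRange_toGNS.induction_on v (isClosed_eq (by fun_prop) (by fun_prop)) fun c => ?_
    rw [← inner_commutator, h, zero_apply, inner_zero_right]

namespace IsTracialState

theorem mul_nonneg (hτ : IsTracialState τ) {a b : A} (ha : 0 ≤ a) (hb : 0 ≤ b) :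
    0 ≤ τ (a * b) := by
  obtain ⟨c, rfl⟩ := CStarAlgebra.nonneg_iff_eq_star_mul_self.1 ha
  rw [mul_assoc, hτ.map_mul_comm]
  exact τ.map_nonneg (star_right_conjugate_nonneg hb c)

theorem norm_toGNS_star (hτ : IsTracialState τ) (a : A) : ‖toGNS τ (star a)‖ = ‖toGNS τ a‖ := by
  have h : ((‖toGNS τ (star a)‖ ^ 2 : ℝ) : ℂ) = (‖toGNS τ a‖ ^ 2 : ℝ) := by
    rw [norm_toGNS_sq, norm_toGNS_sq, star_star, hτ.map_mul_comm]
  exact (sq_eq_sq₀ (norm_nonneg _) (norm_nonneg _)).1 (mod_cast h)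

theorem norm_toGNS_mul_le (hτ : IsTracialState τ) (a b : A) :
    ‖toGNS τ (a * b)‖ ≤ ‖b‖ * ‖toGNS τ a‖ :=
  calc ‖toGNS τ (a * b)‖ = ‖τ.gnsStarAlgHom (star b) (toGNS τ (star a))‖ := by
        rw [gnsStarAlgHom_toGNS, ← star_mul, hτ.norm_toGNS_star]
    _ ≤ ‖b‖ * ‖toGNS τ a‖ := by
        simpa [hτ.norm_toGNS_star] using norm_gnsStarAlgHom_apply_le (star b) (toGNS τ (star a))

/-- Right multiplication by `b` on the GNS space of a tracial state. -/
def rightMul (hτ : IsTracialState τ) (b : A) : τ.GNS →L[ℂ] τ.GNS :=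
  ((τ.toPreGNS.toLinearMap ∘ₗ LinearMap.mulRight ℂ b ∘ₗ
    τ.ofPreGNS.toLinearMap : τ.PreGNS →ₗ[ℂ] τ.PreGNS).mkContinuous ‖b‖ fun a => by
      simpa [toGNS] using hτ.norm_toGNS_mul_le (τ.ofPreGNS a) b).completion

theorem rightMul_toGNS (hτ : IsTracialState τ) (a b : A) :
    hτ.rightMul b (toGNS τ a) = toGNS τ (a * b) :=
  ContinuousLinearMap.completion_apply_coe _ _

theorem commute_gnsStarAlgHom_rightMul (hτ : IsTracialState τ) (a b : A) :
    Commute (τ.gnsStarAlgHom a) (hτ.rightMul b) :=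
  continuousLinearMap_ext_toGNS fun c => by
    simp only [mul_apply_eq_comp, rightMul_toGNS, gnsStarAlgHom_toGNS, mul_assoc]

theorem star_rightMul (hτ : IsTracialState τ) (b : A) :
    star (hτ.rightMul b) = hτ.rightMul (star b) := by
  rw [ContinuousLinearMap.star_eq_adjoint, eq_comm, ContinuousLinearMap.eq_adjoint_iff]
  refine denseRange_toGNS.induction_on₂ (isClosed_eq (by fun_prop) (by fun_prop)) fun a c => ?_
  rw [rightMul_toGNS, rightMul_toGNS, inner_toGNS, inner_toGNS, star_mul, star_star, mul_assoc,
    hτ.map_mul_comm, mul_assoc]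

/-- Right multiplication on the GNS space of a tracial state, as a representation of the opposite
algebra. -/
def rightMulHom (hτ : IsTracialState τ) : Aᵐᵒᵖ →⋆ₐ[ℂ] (τ.GNS →L[ℂ] τ.GNS) where
  toFun b := hτ.rightMul b.unop
  map_one' := continuousLinearMap_ext_toGNS fun c => by simp [rightMul_toGNS]
  map_mul' a b := continuousLinearMap_ext_toGNS fun c => by simp [rightMul_toGNS, mul_assoc]
  map_zero' := continuousLinearMap_ext_toGNS fun c => by simp [rightMul_toGNS]
  map_add' a b := continuousLinearMap_ext_toGNS fun c => by simp [rightMul_toGNS, mul_add]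
  commutes' z := continuousLinearMap_ext_toGNS fun c => by
    simp [rightMul_toGNS, Algebra.algebraMap_eq_smul_one]
  map_star' b := (hτ.star_rightMul b.unop).symm

end IsTracialState

end GNS

/-! ### Vector functionals -/

section VectorFunctional

variable {A : Type*} [CStarAlgebra A] [PartialOrder A] [StarOrderedRing A]
  {H : Type*} [NormedAddCommGroup H] [InnerProductSpace ℂ H] [CompleteSpace H]

/-- The positive functional `a ↦ ⟨ψ, π(a) ψ⟩` of a vector in a representation. -/
def vectorFunctional (π : A →⋆ₐ[ℂ] (H →L[ℂ] H)) (ψ : H) : A →ₚ[ℂ] ℂ :=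
  PositiveLinearMap.mk₀
    { toFun := fun a => ⟪ψ, π a ψ⟫_ℂ
      map_add' := fun a b => by rw [map_add, add_apply, inner_add_right]
      map_smul' := fun c a => by rw [map_smul, smul_apply, inner_smul_right]; rfl }
    fun _ ha =>
      ((ContinuousLinearMap.nonneg_iff_isPositive _).1 (map_nonneg π ha)).inner_nonneg_right ψ

theorem vectorFunctional_apply (π : A →⋆ₐ[ℂ] (H →L[ℂ] H)) (ψ : H) (a : A) :
    vectorFunctional π ψ a = ⟪ψ, π a ψ⟫_ℂ := rfl

theorem vectorFunctional_star_mul (π : A →⋆ₐ[ℂ] (H →L[ℂ] H)) (ψ : H) (a b : A) :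
    vectorFunctional π ψ (star a * b) = ⟪π a ψ, π b ψ⟫_ℂ := by
  rw [vectorFunctional_apply, map_mul, map_star, mul_apply_eq_comp,
    ContinuousLinearMap.star_eq_adjoint, ContinuousLinearMap.adjoint_inner_right]

theorem norm_toGNS_vectorFunctional (π : A →⋆ₐ[ℂ] (H →L[ℂ] H)) (ψ : H) (a : A) :
    ‖toGNS (vectorFunctional π ψ) a‖ = ‖π a ψ‖ := by
  have h : ((‖toGNS (vectorFunctional π ψ) a‖ ^ 2 : ℝ) : ℂ) = (‖π a ψ‖ ^ 2 : ℝ) := by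
    rw [norm_toGNS_sq, vectorFunctional_star_mul, inner_self_eq_norm_sq_to_K,
      RCLike.ofReal_eq_complex_ofReal, Complex.ofReal_pow]
  exact (sq_eq_sq₀ (norm_nonneg _) (norm_nonneg _)).1 (mod_cast h)

theorem exists_linearIsometry_gns_vectorFunctional (π : A →⋆ₐ[ℂ] (H →L[ℂ] H)) (ψ : H) :
    ∃ V : (vectorFunctional π ψ).GNS →ₗᵢ[ℂ] H, ∀ a, V (toGNS _ a) = π a ψ := by
  let orbit : A →ₗ[ℂ] H := (ContinuousLinearMap.apply ℂ H ψ).toLinearMap ∘ₗ π.toLinearMap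
  let V := orbit.extendOfNorm (toGNS (vectorFunctional π ψ))
  have hV (a) : V (toGNS _ a) = π a ψ :=
    LinearMap.extendOfNorm_eq denseRange_toGNS
      ⟨1, fun b => by rw [one_mul, norm_toGNS_vectorFunctional]; rfl⟩ a
  refine ⟨⟨V.toLinearMap, fun v => ?_⟩, hV⟩
  refine denseRange_toGNS.induction_on v (isClosed_eq V.continuous.norm continuous_norm) fun a => ?_
  rw [norm_toGNS_vectorFunctional, ← hV]
  rfl

theorem hasFiniteDimensionalGNS_vectorFunctional [FiniteDimensional ℂ H]
    (π : A →⋆ₐ[ℂ] (H →L[ℂ] H)) (ψ : H) : HasFiniteDimensionalGNS (vectorFunctional π ψ) :=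
  have ⟨V, _⟩ := exists_linearIsometry_gns_vectorFunctional π ψ
  FiniteDimensional.of_injective V.toLinearMap V.injective

theorem hasAbelianGNS_vectorFunctional {π : A →⋆ₐ[ℂ] (H →L[ℂ] H)}
    (hπ : ∀ a b, Commute (π a) (π b)) (ψ : H) : HasAbelianGNS (vectorFunctional π ψ) := by
  refine hasAbelianGNS_iff.2 fun a b c d => ?_
  rw [vectorFunctional_apply, map_mul, map_mul, map_sub, map_mul, map_mul, (hπ a b).eq, sub_self,
    zero_mul, mul_zero, zero_apply, inner_zero_right]

end VectorFunctional

/-! ### Tracial vector states -/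

section TracialVectorState

variable {A : Type*} [CStarAlgebra A] [PartialOrder A] [StarOrderedRing A]
  {H : Type*} [NormedAddCommGroup H] [InnerProductSpace ℂ H] [CompleteSpace H]

/-- The centralizer of a positive functional `φ`: the subalgebra of all `b` such that
`φ(ab) = φ(ba)` for every `a`. -/
def functionalCentralizer (φ : A →ₚ[ℂ] ℂ) : Subalgebra ℂ A where
  carrier := {b | ∀ a, φ (a * b) = φ (b * a)}
  mul_mem' {b c} hb hc a := by rw [← mul_assoc, hc, ← mul_assoc, hb, mul_assoc]
  add_mem' {b c} hb hc a := by rw [mul_add, map_add, hb, hc, add_mul, map_add]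
  algebraMap_mem' z a := by rw [Algebra.commutes]

theorem isClosed_functionalCentralizer (φ : A →ₚ[ℂ] ℂ) :
    IsClosed (functionalCentralizer φ : Set A) := by
  change IsClosed {b | ∀ a, φ (a * b) = φ (b * a)}
  rw [Set.ofPred_forall]
  exact isClosed_iInter fun a => isClosed_eq (by fun_prop) (by fun_prop)

theorem mem_functionalCentralizer_vectorFunctional {π : A →⋆ₐ[ℂ] (H →L[ℂ] H)} {ψ : H}
    {T : H →L[ℂ] H} (hT : IsSelfAdjoint T) (hπT : ∀ a, Commute (π a) T) {b : A}
    (hb : IsSelfAdjoint b) (hbT : π b ψ = T ψ) :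
    b ∈ functionalCentralizer (vectorFunctional π ψ) := fun a =>
  calc vectorFunctional π ψ (a * b) = ⟪ψ, (π a * T) ψ⟫_ℂ := by
        rw [vectorFunctional_apply, map_mul, mul_apply_eq_comp, hbT, mul_apply_eq_comp]
    _ = ⟪T ψ, π a ψ⟫_ℂ := by
        rw [(hπT a).eq, mul_apply_eq_comp, ← ContinuousLinearMap.adjoint_inner_left,
          ← ContinuousLinearMap.star_eq_adjoint, hT.star_eq]
    _ = vectorFunctional π ψ (b * a) := by
        rw [← hbT, ← vectorFunctional_star_mul, hb.star_eq]

theorem vectorFunctional_one (π : A →⋆ₐ[ℂ] (H →L[ℂ] H)) {ψ : H} (hψ : ‖ψ‖ = 1) :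
    vectorFunctional π ψ 1 = 1 := by
  rw [vectorFunctional_apply, map_one, one_apply_eq_self, inner_self_eq_norm_sq_to_K, hψ,
    RCLike.ofReal_one, one_pow]

end TracialVectorState

section Synchronous

variable {H : Type*} [NormedAddCommGroup H] [InnerProductSpace ℂ H] [CompleteSpace H]

theorem apply_eq_zero_of_inner_apply_eq_zero {P : H →L[ℂ] H} (hP : IsStarProjection P) {v : H}
    (hv : ⟪v, P v⟫_ℂ = 0) : P v = 0 := by
  rwa [← hP.isIdempotentElem.eq, mul_apply_eq_comp, ← ContinuousLinearMap.adjoint_inner_left,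
    ← ContinuousLinearMap.star_eq_adjoint, hP.isSelfAdjoint.star_eq, inner_self_eq_zero] at hv

theorem IsProjectionPartition.apply_eq_apply {ι : Type*} [Fintype ι] {P Q : ι → (H →L[ℂ] H)}
    (hP : IsProjectionPartition P) (hQ : IsProjectionPartition Q)
    (hPQ : ∀ a b, Commute (P a) (Q b)) {ψ : H}
    (hψ : ∀ a b, a ≠ b → ⟪ψ, (P a * Q b) ψ⟫_ℂ = 0) (a : ι) : P a ψ = Q a ψ := by
  have hzero (a b) (hab : a ≠ b) : P a (Q b ψ) = 0 :=
    apply_eq_zero_of_inner_apply_eq_zero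
      ((hP.isStarProjection a).mul (hQ.isStarProjection b) (hPQ a b)) (hψ a b hab)
  calc P a ψ = ∑ c, P a (Q c ψ) := by
        rw [← map_sum, ← sum_apply, hQ.sum_eq_one, one_apply_eq_self]
    _ = P a (Q a ψ) := Fintype.sum_eq_single a fun c hc => hzero a c hc.symm
    _ = ∑ c, P c (Q a ψ) := (Fintype.sum_eq_single a fun c hc => hzero c a hc).symm
    _ = Q a ψ := by rw [← sum_apply, hP.sum_eq_one, one_apply_eq_self]

end Synchronous

section Generators

variable {n m : ℕ} [NeZero m]

open scoped CStarAlgebra in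
theorem commute_of_forall_commute_minProj {B : Type*} [CStarAlgebra B]
    (π : GroupCStar (FreeProdCyclic n m) →⋆ₐ[ℂ] B) {T : B}
    (hT : ∀ x i, Commute (π (minProj x i)) T) (a : GroupCStar (FreeProdCyclic n m)) :
    Commute (π a) T := by
  let S := (Subalgebra.centralizer ℂ {T}).comap π.toAlgHom
  have mem_S (b) : b ∈ S ↔ Commute (π b) T :=
    (Subalgebra.mem_centralizer_iff ℂ).trans (by simp [commute_iff_eq, eq_comm])
  have hS : IsClosed (S : Set (GroupCStar (FreeProdCyclic n m))) :=
    (Set.isClosed_centralizer {T}).preimage (map_continuous π)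
  have h := eq_top_of_minProj_mem hS fun x i => (mem_S _).2 (hT x i)
  exact (mem_S a).1 (h ▸ Algebra.mem_top)

theorem commute_map_of_forall_commute_minProj {B : Type*} [CStarAlgebra B]
    (π : GroupCStar (FreeProdCyclic n m) →⋆ₐ[ℂ] B)
    (hπ : ∀ x y i j, Commute (π (minProj x i)) (π (minProj y j)))
    (a b : GroupCStar (FreeProdCyclic n m)) : Commute (π a) (π b) :=
  commute_of_forall_commute_minProj π (fun x i =>
    (commute_of_forall_commute_minProj π (fun y j => hπ y x j i) b).symm) a

end Generators

/-! ### Correlations of tracial states -/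

section TraceCorrelation

variable {n m : ℕ} [NeZero m]

/-- The correlation `p(i,j|x,y) = τ(e_{x,i} e_{y,j})` of a tracial state `τ`. The real part only
serves to define it for every functional: the values of a tracial state are real here. -/
def traceCorrelation (τ : GroupCStar (FreeProdCyclic n m) →ₚ[ℂ] ℂ) : Correlation n m :=
  fun x y i j => (τ (minProj x i * minProj y j)).re

namespace IsTracialState

variable {τ : GroupCStar (FreeProdCyclic n m) →ₚ[ℂ] ℂ}

theorem coe_traceCorrelation (hτ : IsTracialState τ) (x y : Fin n) (i j : Fin m) :
    (traceCorrelation τ x y i j : ℂ) = τ (minProj x i * minProj y j) :=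
  (Complex.eq_re_of_ofReal_le (hτ.mul_nonneg
    ((isProjectionPartition_minProj x).isStarProjection i).nonneg
    ((isProjectionPartition_minProj y).isStarProjection j).nonneg)).symm

theorem traceCorrelation_mem_synchronous (hτ : IsTracialState τ) :
    traceCorrelation τ ∈ synchronous n m := fun x a b hab => by
  rw [← Complex.ofReal_inj, hτ.coe_traceCorrelation,
    (isProjectionPartition_minProj x).mul_eq_zero hab, map_zero, Complex.ofReal_zero]

theorem traceCorrelation_mem_Cqc (hτ : IsTracialState τ) : traceCorrelation τ ∈ Cqc n m := by
  refine ⟨τ.GNS, inferInstance, inferInstance, inferInstance,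
    fun x i => τ.gnsStarAlgHom (minProj x i), fun y j => hτ.rightMul (minProj y j), toGNS τ 1,
    isProjectiveMeasurement_iff.2 fun x => (isProjectionPartition_minProj x).map _,
    isProjectiveMeasurement_iff.2 fun y => (isProjectionPartition_minProj y).op.map hτ.rightMulHom,
    fun x y i j => hτ.commute_gnsStarAlgHom_rightMul _ _, norm_toGNS_one hτ.map_one,
    fun x y i j => ?_⟩
  rw [hτ.coe_traceCorrelation, mul_apply_eq_comp, hτ.rightMul_toGNS, gnsStarAlgHom_toGNS,
    inner_toGNS, star_one, one_mul, one_mul]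

theorem traceCorrelation_mem_Cloc (hτ : IsTracialState τ) (hab : HasAbelianGNS τ) :
    traceCorrelation τ ∈ Cloc n m := by
  have hE : IsProjectiveMeasurement fun (x : Fin n) (i : Fin m) => τ.gnsStarAlgHom (minProj x i) :=
    isProjectiveMeasurement_iff.2 fun x => (isProjectionPartition_minProj x).map _
  refine ⟨τ.GNS, inferInstance, inferInstance, inferInstance, _, _, toGNS τ 1, hE, hE,
    fun _ _ _ _ => hab _ _, fun _ _ _ _ => hab _ _, fun _ _ _ _ => hab _ _,
    norm_toGNS_one hτ.map_one, fun x y i j => ?_⟩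
  rw [hτ.coe_traceCorrelation, ← map_mul, ← apply_eq_inner_gns]

end IsTracialState

section Strategy

variable {H : Type} [NormedAddCommGroup H] [InnerProductSpace ℂ H] [CompleteSpace H]
  {E F : Fin n → Fin m → (H →L[ℂ] H)} {ψ : H} {p : Correlation n m}

/-- On the state of a synchronous strategy the second player's projections act like the first
player's, so moving them around the commutant makes the vector state tracial. -/
theorem exists_isTracialState_vectorFunctional (hE : IsProjectiveMeasurement E)
    (hF : IsProjectiveMeasurement F) (hEF : ∀ x y a b, Commute (E x a) (F y b)) (hψ : ‖ψ‖ = 1)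
    (hp : ∀ x y a b, (p x y a b : ℂ) = ⟪ψ, (E x a * F y b) ψ⟫_ℂ) (hs : p ∈ synchronous n m) :
    ∃ π : GroupCStar (FreeProdCyclic n m) →⋆ₐ[ℂ] (H →L[ℂ] H),
      (∀ x i, π (minProj x i) = E x i) ∧ IsTracialState (vectorFunctional π ψ) ∧
      traceCorrelation (vectorFunctional π ψ) = p := by
  obtain ⟨π, hπ⟩ := hE.exists_starAlgHom
  have hEFψ (x i) : E x i ψ = F x i ψ :=
    (isProjectiveMeasurement_iff.1 hE x).apply_eq_apply (isProjectiveMeasurement_iff.1 hF x)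
      (hEF x x) (fun a b hab => by rw [← hp, hs x a b hab, Complex.ofReal_zero]) i
  have htop : functionalCentralizer (vectorFunctional π ψ) = ⊤ :=
    eq_top_of_minProj_mem (isClosed_functionalCentralizer _) fun x i =>
      mem_functionalCentralizer_vectorFunctional (hF.1 x i).isSelfAdjoint
        (commute_of_forall_commute_minProj π fun y j => by rw [hπ]; exact hEF y x j i)
        ((isProjectionPartition_minProj x).isStarProjection i).isSelfAdjoint
        (by rw [hπ, hEFψ])
  refine ⟨π, hπ, ⟨vectorFunctional_one π hψ, fun a b => ?_⟩, ?_⟩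
  · exact (htop ▸ Algebra.mem_top : b ∈ functionalCentralizer (vectorFunctional π ψ)) a
  · ext x y i j
    rw [traceCorrelation, vectorFunctional_apply, map_mul, hπ, hπ, mul_apply_eq_comp, hEFψ,
      ← mul_apply_eq_comp, ← hp, Complex.ofReal_re]

end Strategy

theorem Cqc_inter_synchronous :
    Cqc n m ∩ synchronous n m = traceCorrelation '' {τ | IsTracialState τ} := by
  refine Set.Subset.antisymm ?_ ?_
  · rintro p ⟨⟨H, _, _, _, E, F, ψ, hE, hF, hEF, hψ, hp⟩, hs⟩
    obtain ⟨π, -, hτ, rfl⟩ := exists_isTracialState_vectorFunctional hE hF hEF hψ hp hs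
    exact ⟨_, hτ, rfl⟩
  · rintro _ ⟨τ, hτ, rfl⟩
    exact ⟨hτ.traceCorrelation_mem_Cqc, hτ.traceCorrelation_mem_synchronous⟩

theorem Cloc_inter_synchronous :
    Cloc n m ∩ synchronous n m =
      traceCorrelation '' {τ | IsTracialState τ ∧ HasAbelianGNS τ} := by
  refine Set.Subset.antisymm ?_ ?_
  · rintro p ⟨⟨H, _, _, _, E, F, ψ, hE, hF, hEF, hEE, -, hψ, hp⟩, hs⟩
    obtain ⟨π, hπ, hτ, rfl⟩ := exists_isTracialState_vectorFunctional hE hF hEF hψ hp hs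
    have hcomm := commute_map_of_forall_commute_minProj π fun x y i j => by
      simpa only [hπ] using hEE x y i j
    exact ⟨_, ⟨hτ, hasAbelianGNS_vectorFunctional hcomm ψ⟩, rfl⟩
  · rintro _ ⟨τ, ⟨hτ, hab⟩, rfl⟩
    exact ⟨hτ.traceCorrelation_mem_Cloc hab, hτ.traceCorrelation_mem_synchronous⟩

end TraceCorrelation

/-! ### Finite dimensional traces -/

theorem exists_isSelfAdjoint_mul_mul_self_eq_one {A : Type*} [CStarAlgebra A] [PartialOrder A]
    [StarOrderedRing A] {a : A} (ha : IsStrictlyPositive a) :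
    ∃ b, IsSelfAdjoint b ∧ (∀ c, Commute a c → Commute b c) ∧ a * (b * b) = 1 := by
  refine ⟨a ^ (-(1 / 2) : ℝ), CFC.rpow_nonneg.isSelfAdjoint, fun c hc => hc.cfc_nnreal _, ?_⟩
  calc a * (a ^ (-(1 / 2) : ℝ) * a ^ (-(1 / 2) : ℝ)) = a ^ (1 : ℝ) * a ^ (-1 : ℝ) := by
        rw [← CFC.rpow_add ha.isUnit, CFC.rpow_one a ha.nonneg]
        norm_num
    _ = 1 := CFC.rpow_mul_rpow_neg 1

section FiniteDimensionalTrace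

variable {A : Type*} [CStarAlgebra A] [PartialOrder A] [StarOrderedRing A] {τ : A →ₚ[ℂ] ℂ}

theorem surjective_toGNS [FiniteDimensional ℂ τ.GNS] : Function.Surjective (toGNS τ) := by
  have hclosed : IsClosed ((toGNS τ).range : Set τ.GNS) := Submodule.closed_of_finiteDimensional _
  rw [← Set.range_eq_univ, ← LinearMap.coe_range, ← hclosed.closure_eq]
  exact denseRange_toGNS.closure_eq

/-- The element `∑ a_k a_k⋆`, analogous to a Casimir element. When the `a_k` represent an
orthonormal basis of the GNS space of a trace, it relates the operator trace to the given one. -/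
def casimir {ι : Type*} [Fintype ι] (a : ι → A) : A :=
  ∑ k, a k * star (a k)

namespace IsTracialState

variable {ι : Type*} [Fintype ι] {e : OrthonormalBasis ι ℂ τ.GNS} {a : ι → A}

theorem trace_eq_inner_casimir (hτ : IsTracialState τ) (ha : ∀ k, toGNS τ (a k) = e k)
    {X : τ.GNS →L[ℂ] τ.GNS} (hX : ∀ b, Commute X (hτ.rightMul b)) :
    LinearMap.trace ℂ τ.GNS X = ⟪toGNS τ (casimir a), X (toGNS τ 1)⟫_ℂ := by
  have hterm (k) : ⟪e k, X (e k)⟫_ℂ = ⟪toGNS τ (a k * star (a k)), X (toGNS τ 1)⟫_ℂ :=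
    calc ⟪e k, X (e k)⟫_ℂ = ⟪toGNS τ (a k), (X * hτ.rightMul (a k)) (toGNS τ 1)⟫_ℂ := by
          rw [mul_apply_eq_comp, hτ.rightMul_toGNS, one_mul, ha]
      _ = ⟪hτ.rightMul (star (a k)) (toGNS τ (a k)), X (toGNS τ 1)⟫_ℂ := by
          rw [(hX _).eq, mul_apply_eq_comp, ← hτ.star_rightMul, ContinuousLinearMap.star_eq_adjoint,
            ContinuousLinearMap.adjoint_inner_left]
      _ = ⟪toGNS τ (a k * star (a k)), X (toGNS τ 1)⟫_ℂ := by rw [hτ.rightMul_toGNS]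
  rw [LinearMap.trace_eq_sum_inner _ e, casimir, map_sum, sum_inner]
  exact Finset.sum_congr rfl fun k _ => hterm k

theorem trace_gnsStarAlgHom (hτ : IsTracialState τ) (ha : ∀ k, toGNS τ (a k) = e k) (b : A) :
    LinearMap.trace ℂ τ.GNS (τ.gnsStarAlgHom b) = τ (b * casimir a) := by
  have hstar : star (casimir a) = casimir a := by simp [casimir]
  rw [hτ.trace_eq_inner_casimir ha (hτ.commute_gnsStarAlgHom_rightMul b), gnsStarAlgHom_toGNS,
    inner_toGNS, hstar, mul_one, hτ.map_mul_comm]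

theorem toGNS_casimir_mul (hτ : IsTracialState τ) (ha : ∀ k, toGNS τ (a k) = e k) (b : A) :
    toGNS τ (casimir a * b) = toGNS τ (b * casimir a) := by
  refine ext_inner_left ℂ fun v => denseRange_toGNS.induction_on v
    (isClosed_eq (by fun_prop) (by fun_prop)) fun x => ?_
  calc ⟪toGNS τ x, toGNS τ (casimir a * b)⟫_ℂ = τ (b * star x * casimir a) := by
        rw [inner_toGNS, ← mul_assoc, hτ.map_mul_comm, mul_assoc]
    _ = τ (star x * b * casimir a) := by
        rw [← hτ.trace_gnsStarAlgHom ha, ← hτ.trace_gnsStarAlgHom ha, map_mul, map_mul]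
        exact LinearMap.trace_mul_comm ℂ _ _
    _ = ⟪toGNS τ x, toGNS τ (b * casimir a)⟫_ℂ := by rw [inner_toGNS, mul_assoc]

theorem commute_gnsStarAlgHom_casimir (hτ : IsTracialState τ) (ha : ∀ k, toGNS τ (a k) = e k)
    (b : A) : Commute (τ.gnsStarAlgHom (casimir a)) (τ.gnsStarAlgHom b) :=
  continuousLinearMap_ext_toGNS fun d => by
    simp only [mul_apply_eq_comp, gnsStarAlgHom_toGNS, hτ.toGNS_casimir_mul ha, mul_assoc]

theorem toGNS_eq_zero_of_casimir_mul (hτ : IsTracialState τ) (ha : ∀ k, toGNS τ (a k) = e k)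
    {b : A} (hb : toGNS τ (casimir a * b) = 0) : toGNS τ b = 0 := by
  have hsum : ∑ k, ‖toGNS τ (star (a k) * b)‖ ^ 2 = 0 := by
    rw [← Complex.ofReal_inj, Complex.ofReal_sum, Complex.ofReal_zero,
      ← inner_zero_right (𝕜 := ℂ) (toGNS τ b), ← hb, inner_toGNS]
    simp only [norm_toGNS_sq, star_mul, star_star, casimir, Finset.sum_mul, Finset.mul_sum, map_sum,
      mul_assoc]
  have hterm (k) : toGNS τ (star b * a k) = 0 := by
    rw [← norm_eq_zero, ← hτ.norm_toGNS_star, star_mul, star_star]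
    exact sq_eq_zero_iff.1
      (congr_fun ((Fintype.sum_eq_zero_iff_of_nonneg fun _ => sq_nonneg _).1 hsum) k)
  have hzero : τ.gnsStarAlgHom (star b) = 0 :=
    ContinuousLinearMap.coe_injective <| e.toBasis.ext fun k => by
      change τ.gnsStarAlgHom (star b) (e.toBasis k) = 0
      rw [e.coe_toBasis, ← ha, gnsStarAlgHom_toGNS, hterm]
  rw [← norm_eq_zero, ← hτ.norm_toGNS_star, norm_eq_zero, ← mul_one (star b),
    ← gnsStarAlgHom_toGNS, hzero, zero_apply]

theorem isStrictlyPositive_gnsStarAlgHom_casimir [FiniteDimensional ℂ τ.GNS]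
    (hτ : IsTracialState τ) (ha : ∀ k, toGNS τ (a k) = e k) :
    IsStrictlyPositive (τ.gnsStarAlgHom (casimir a)) := by
  have hinj : Function.Injective (τ.gnsStarAlgHom (casimir a)) := by
    refine (injective_iff_map_eq_zero _).2 fun v hv => ?_
    obtain ⟨b, rfl⟩ := surjective_toGNS v
    exact hτ.toGNS_eq_zero_of_casimir_mul ha (by rwa [← gnsStarAlgHom_toGNS])
  refine ⟨map_nonneg _ (Finset.sum_nonneg fun k _ => mul_star_self_nonneg (a k)), ?_⟩
  exact ContinuousLinearMap.isUnit_iff_bijective.2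
    ⟨hinj, LinearMap.injective_iff_surjective.1 hinj⟩

theorem exists_trace_mul_mul_gnsStarAlgHom [FiniteDimensional ℂ τ.GNS] (hτ : IsTracialState τ)
    (ha : ∀ k, toGNS τ (a k) = e k) :
    ∃ W : τ.GNS →L[ℂ] τ.GNS, IsSelfAdjoint W ∧ (∀ b, Commute W (τ.gnsStarAlgHom b)) ∧
      ∀ b, LinearMap.trace ℂ τ.GNS ↑(W * W * τ.gnsStarAlgHom b) = τ b := by
  let T := τ.gnsStarAlgHom (casimir a)
  have hT : IsStrictlyPositive T := hτ.isStrictlyPositive_gnsStarAlgHom_casimir ha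
  obtain ⟨W, hW, commute_W, hTWW⟩ := exists_isSelfAdjoint_mul_mul_self_eq_one hT
  refine ⟨W, hW, fun b => commute_W _ (hτ.commute_gnsStarAlgHom_casimir ha b), fun b => ?_⟩
  have hWR (c) : Commute W (hτ.rightMul c) := commute_W _ (hτ.commute_gnsStarAlgHom_rightMul _ c)
  rw [hτ.trace_eq_inner_casimir ha fun c =>
    ((hWR c).mul_left (hWR c)).mul_left (hτ.commute_gnsStarAlgHom_rightMul b c)]
  calc ⟪toGNS τ (casimir a), (W * W * τ.gnsStarAlgHom b) (toGNS τ 1)⟫_ℂ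
      = ⟪toGNS τ 1, (T * (W * W) * τ.gnsStarAlgHom b) (toGNS τ 1)⟫_ℂ := by
        rw [mul_assoc T, mul_apply_eq_comp T, ← ContinuousLinearMap.adjoint_inner_left T,
          ← ContinuousLinearMap.star_eq_adjoint, hT.nonneg.isSelfAdjoint.star_eq,
          gnsStarAlgHom_toGNS, mul_one]
    _ = τ b := by rw [hTWW, one_mul, ← apply_eq_inner_gns]

/-- The purification `∑ W e_k ⊗ J e_k` with `J` the conjugation `a ↦ a⋆` of the GNS space. -/
theorem exists_inner_map_gns_eq [FiniteDimensional ℂ τ.GNS] (hτ : IsTracialState τ) :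
    ∃ ψ : τ.GNS ⊗[ℂ] τ.GNS, ∀ b c,
      ⟪ψ, TensorProduct.map (τ.gnsStarAlgHom b : τ.GNS →ₗ[ℂ] τ.GNS)
        (hτ.rightMul c : τ.GNS →ₗ[ℂ] τ.GNS) ψ⟫_ℂ = τ (b * c) := by
  let e := stdOrthonormalBasis ℂ τ.GNS
  choose a ha using fun k => surjective_toGNS (e k)
  obtain ⟨W, hW, hWL, htrace⟩ := hτ.exists_trace_mul_mul_gnsStarAlgHom ha
  have hconj (c k l) : ⟪toGNS τ (star (a k)), hτ.rightMul c (toGNS τ (star (a l)))⟫_ℂ =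
      ⟪e l, τ.gnsStarAlgHom c (e k)⟫_ℂ := by
    rw [← ha, ← ha, hτ.rightMul_toGNS, gnsStarAlgHom_toGNS, inner_toGNS, inner_toGNS, star_star,
      hτ.map_mul_comm, mul_assoc]
  refine ⟨∑ k, W (e k) ⊗ₜ toGNS τ (star (a k)), fun b c => ?_⟩
  have hrow (k) : ∑ l, ⟪W (e k), τ.gnsStarAlgHom b (W (e l))⟫_ℂ *
      ⟪toGNS τ (star (a k)), hτ.rightMul c (toGNS τ (star (a l)))⟫_ℂ =
      ⟪e k, (W * W * τ.gnsStarAlgHom (b * c)) (e k)⟫_ℂ :=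
    calc _ = ⟪W (e k), τ.gnsStarAlgHom b (W (τ.gnsStarAlgHom c (e k)))⟫_ℂ := by
          conv_rhs => rw [← e.sum_repr' (τ.gnsStarAlgHom c (e k))]
          simp only [hconj, map_sum, map_smul, inner_sum, inner_smul_right, mul_comm]
      _ = ⟪e k, (W * W * τ.gnsStarAlgHom (b * c)) (e k)⟫_ℂ := by
          rw [← ContinuousLinearMap.adjoint_inner_right, ← ContinuousLinearMap.star_eq_adjoint,
            hW.star_eq, map_mul, mul_assoc, ← mul_assoc W (τ.gnsStarAlgHom b), (hWL b).eq]
          rfl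
  rw [← htrace, LinearMap.trace_eq_sum_inner _ e]
  simp only [map_sum, TensorProduct.map_tmul, inner_sum, sum_inner, TensorProduct.inner_tmul]
  rw [Finset.sum_comm]
  exact Finset.sum_congr rfl fun k _ => hrow k

end IsTracialState

end FiniteDimensionalTrace

/-! ### Quantum correlations -/

section TensorRepresentations

variable (HA HB : Type*) [NormedAddCommGroup HA] [InnerProductSpace ℂ HA] [CompleteSpace HA]
  [NormedAddCommGroup HB] [InnerProductSpace ℂ HB] [CompleteSpace HB] [CompleteSpace (HA ⊗[ℂ] HB)]

/-- The representation `S ↦ S ⊗ 1` of the operators on `HA` on the tensor product `HA ⊗ HB`. -/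
def rTensorStarAlgHom : (HA →L[ℂ] HA) →⋆ₐ[ℂ] (HA ⊗[ℂ] HB →L[ℂ] HA ⊗[ℂ] HB) where
  toFun S := S.rTensor HB
  map_one' := ContinuousLinearMap.rTensor_one _
  map_mul' := ContinuousLinearMap.rTensor_mul _
  map_zero' := ContinuousLinearMap.rTensor_zero _
  map_add' := ContinuousLinearMap.rTensor_add _
  commutes' z := by
    rw [Algebra.algebraMap_eq_smul_one, Algebra.algebraMap_eq_smul_one,
      ContinuousLinearMap.rTensor_smul, ContinuousLinearMap.rTensor_one]
  map_star' S := (ContinuousLinearMap.adjoint_rTensor _ S).symm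

/-- The representation `T ↦ 1 ⊗ T` of the operators on `HB` on the tensor product `HA ⊗ HB`. -/
def lTensorStarAlgHom : (HB →L[ℂ] HB) →⋆ₐ[ℂ] (HA ⊗[ℂ] HB →L[ℂ] HA ⊗[ℂ] HB) where
  toFun T := T.lTensor HA
  map_one' := ContinuousLinearMap.lTensor_one _
  map_mul' := ContinuousLinearMap.lTensor_mul _
  map_zero' := ContinuousLinearMap.lTensor_zero _
  map_add' := ContinuousLinearMap.lTensor_add _
  commutes' z := by
    rw [Algebra.algebraMap_eq_smul_one, Algebra.algebraMap_eq_smul_one,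
      ContinuousLinearMap.lTensor_smul, ContinuousLinearMap.lTensor_one]
  map_star' T := (ContinuousLinearMap.adjoint_lTensor _ T).symm

variable {HA HB}

theorem commute_rTensorStarAlgHom_lTensorStarAlgHom (S : HA →L[ℂ] HA) (T : HB →L[ℂ] HB) :
    Commute (rTensorStarAlgHom HA HB S) (lTensorStarAlgHom HA HB T) :=
  (ContinuousLinearMap.rTensor_comp_lTensor S T).trans
    (ContinuousLinearMap.lTensor_comp_rTensor T S).symm

theorem rTensorStarAlgHom_mul_lTensorStarAlgHom_apply (S : HA →L[ℂ] HA) (T : HB →L[ℂ] HB)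
    (v : HA ⊗[ℂ] HB) : (rTensorStarAlgHom HA HB S * lTensorStarAlgHom HA HB T) v =
      TensorProduct.map (S : HA →ₗ[ℂ] HA) (T : HB →ₗ[ℂ] HB) v :=
  (DFunLike.congr_fun (ContinuousLinearMap.rTensor_comp_lTensor S T) v).trans
    (TensorProduct.mapL_apply S T v)

end TensorRepresentations

section QuantumCorrelations

variable {n m : ℕ} [NeZero m]

theorem IsTracialState.traceCorrelation_mem_Cq {τ : GroupCStar (FreeProdCyclic n m) →ₚ[ℂ] ℂ}
    (hτ : IsTracialState τ) (hfd : HasFiniteDimensionalGNS τ) : traceCorrelation τ ∈ Cq n m := by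
  have : FiniteDimensional ℂ τ.GNS := hfd
  obtain ⟨ψ, hψ⟩ := hτ.exists_inner_map_gns_eq
  have hnorm : ‖ψ‖ = 1 := by
    have hright : hτ.rightMul 1 = 1 := _root_.map_one hτ.rightMulHom
    have h : ⟪ψ, ψ⟫_ℂ = 1 := by
      simpa only [_root_.map_one, hright, one_mul, hτ.map_one, ContinuousLinearMap.toLinearMap_one,
        TensorProduct.map_one, Module.End.one_apply] using hψ 1 1
    rw [inner_self_eq_norm_sq_to_K (𝕜 := ℂ) ψ, RCLike.ofReal_eq_complex_ofReal] at h
    exact (pow_eq_one_iff_of_nonneg (norm_nonneg _) two_ne_zero).1 (mod_cast h)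
  refine ⟨τ.GNS, inferInstance, inferInstance, inferInstance, hfd,
    τ.GNS, inferInstance, inferInstance, inferInstance, hfd,
    fun x i => τ.gnsStarAlgHom (minProj x i), fun y j => hτ.rightMul (minProj y j), ψ,
    isProjectiveMeasurement_iff.2 fun x => (isProjectionPartition_minProj x).map _,
    isProjectiveMeasurement_iff.2 fun y => (isProjectionPartition_minProj y).op.map hτ.rightMulHom,
    hnorm, fun x y i j => ?_⟩
  rw [hτ.coe_traceCorrelation, hψ]

theorem Cq_inter_synchronous :
    Cq n m ∩ synchronous n m =
      traceCorrelation '' {τ | IsTracialState τ ∧ HasFiniteDimensionalGNS τ} := by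
  refine Set.Subset.antisymm ?_ ?_
  · rintro p ⟨⟨HA, _, _, _, _, HB, _, _, _, _, E, F, ψ, hE, hF, hψ, hp⟩, hs⟩
    have : CompleteSpace (HA ⊗[ℂ] HB) := FiniteDimensional.complete ℂ _
    have hE' := isProjectiveMeasurement_iff.2 fun x =>
      (isProjectiveMeasurement_iff.1 hE x).map (rTensorStarAlgHom HA HB)
    have hF' := isProjectiveMeasurement_iff.2 fun y =>
      (isProjectiveMeasurement_iff.1 hF y).map (lTensorStarAlgHom HA HB)
    obtain ⟨π, -, hτ, rfl⟩ := exists_isTracialState_vectorFunctional hE' hF'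
      (fun _ _ _ _ => commute_rTensorStarAlgHom_lTensorStarAlgHom _ _) hψ
      (fun x y a b => by rw [hp, rTensorStarAlgHom_mul_lTensorStarAlgHom_apply]) hs
    exact ⟨_, ⟨hτ, hasFiniteDimensionalGNS_vectorFunctional π ψ⟩, rfl⟩
  · rintro _ ⟨τ, ⟨hτ, hfd⟩, rfl⟩
    exact ⟨hτ.traceCorrelation_mem_Cq hfd, hτ.traceCorrelation_mem_synchronous⟩

end QuantumCorrelations

/-! ### Compactness of the set of tracial states -/

section Compactness

variable {A : Type*} [CStarAlgebra A] [PartialOrder A]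

theorem isClosed_setOf_weakDual_tracialState (N : Set A) :
    IsClosed {f : WeakDual ℂ A | (∀ a, 0 ≤ a → 0 ≤ f a) ∧ f 1 = 1 ∧
      (∀ a b, f (a * b) = f (b * a)) ∧ ∀ a ∈ N, f a = 0} := by
  have heval (a : A) : Continuous fun f : WeakDual ℂ A => f a := WeakDual.eval_continuous a
  simp only [Set.ofPred_and, Set.ofPred_forall]
  exact (isClosed_iInter fun a => isClosed_iInter fun _ =>
      isClosed_le continuous_const (heval a)).inter <|
    (isClosed_eq (heval 1) continuous_const).inter <|
    (isClosed_iInter fun a => isClosed_iInter fun b => isClosed_eq (heval _) (heval _)).inter <|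
    isClosed_iInter fun a => isClosed_iInter fun _ => isClosed_eq (heval a) continuous_const

variable [StarOrderedRing A]

theorem isCompact_image_tracialState (N : Set A) (b : A) :
    IsCompact ((fun τ : A →ₚ[ℂ] ℂ => τ b) '' {τ | IsTracialState τ ∧ ∀ a ∈ N, τ a = 0}) := by
  let K : Set (WeakDual ℂ A) := {f | (∀ a, 0 ≤ a → 0 ≤ f a) ∧ f 1 = 1 ∧
    (∀ a b, f (a * b) = f (b * a)) ∧ ∀ a ∈ N, f a = 0}
  let functional {f} (hf : f ∈ K) : A →ₚ[ℂ] ℂ :=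
    PositiveLinearMap.mk₀ (f : A →L[ℂ] ℂ).toLinearMap hf.1
  have hball : K ⊆ WeakDual.toStrongDual ⁻¹' Metric.closedBall 0 1 := fun f hf =>
    mem_closedBall_zero_iff.2 <| ContinuousLinearMap.opNorm_le_bound _ zero_le_one fun a =>
      (norm_apply_le_of_map_one (τ := functional hf) hf.2.1 a).trans_eq (one_mul _).symm
  have hK : IsCompact K := (WeakDual.isCompact_closedBall 0 1).of_isClosed_subset
    (isClosed_setOf_weakDual_tracialState N) hball
  convert hK.image (WeakDual.eval_continuous b) using 1
  ext z
  constructor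
  · rintro ⟨τ, ⟨hτ, hN⟩, rfl⟩
    exact ⟨StrongDual.toWeakDual (τ.toLinearMap.mkContinuous 1 fun a =>
      (norm_apply_le_of_map_one hτ.map_one a).trans_eq (one_mul _).symm),
      ⟨fun a ha => τ.map_nonneg ha, hτ.map_one, hτ.map_mul_comm, hN⟩, rfl⟩
  · rintro ⟨f, hf, rfl⟩
    exact ⟨functional hf, ⟨⟨hf.2.1, hf.2.2.1⟩, hf.2.2.2⟩, rfl⟩

theorem isCompact_image_isTracialState (b : A) :
    IsCompact ((fun τ : A →ₚ[ℂ] ℂ => τ b) '' {τ | IsTracialState τ}) := by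
  simpa using isCompact_image_tracialState ∅ b

theorem isCompact_image_isTracialState_hasAbelianGNS (b : A) :
    IsCompact ((fun τ : A →ₚ[ℂ] ℂ => τ b) '' {τ | IsTracialState τ ∧ HasAbelianGNS τ}) := by
  let N : Set A := {e | ∃ a b c d, star c * ((a * b - b * a) * d) = e}
  have hN (τ : A →ₚ[ℂ] ℂ) : HasAbelianGNS τ ↔ ∀ e ∈ N, τ e = 0 := by
    rw [hasAbelianGNS_iff]
    refine ⟨?_, fun h a b c d => h _ ⟨a, b, c, d, rfl⟩⟩
    rintro h _ ⟨a, b, c, d, rfl⟩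
    exact h a b c d
  simpa only [hN] using isCompact_image_tracialState N b

end Compactness

/-! ### Values of games -/

theorem isLUB_image_ofReal {V : Set ℝ} {v : ℝ} (hV : V.Nonempty) (h : IsLUB V v) :
    IsLUB (Complex.ofReal '' V) (v : ℂ) := by
  refine ⟨Set.forall_mem_image.2 fun w hw => Complex.real_le_real.2 (h.1 hw), fun z hz => ?_⟩
  obtain ⟨w, hw⟩ := hV
  obtain ⟨z, rfl⟩ : ∃ r : ℝ, (r : ℂ) = z :=
    ⟨z.re, (Complex.eq_re_of_ofReal_le (hz ⟨w, hw, rfl⟩)).symm⟩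
  exact Complex.real_le_real.2 (h.2 fun w hw => Complex.real_le_real.1 (hz ⟨w, hw, rfl⟩))

section Values

variable {n m : ℕ} [NeZero m] (G : Game n m) (Γ : InputDistribution n)

theorem IsTracialState.payoff_traceCorrelation {τ : GroupCStar (FreeProdCyclic n m) →ₚ[ℂ] ℂ}
    (hτ : IsTracialState τ) : (payoff G Γ (traceCorrelation τ) : ℂ) = τ (gameElement G Γ) := by
  simp only [payoff, gameElement, map_sum, map_smul, Complex.ofReal_sum, Complex.ofReal_mul,
    hτ.coe_traceCorrelation, smul_eq_mul]

variable {C : Set (Correlation n m)} {T : Set (GroupCStar (FreeProdCyclic n m) →ₚ[ℂ] ℂ)}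

theorem ofReal_image_payoff (hT : ∀ τ ∈ T, IsTracialState τ)
    (hC : C ∩ synchronous n m = traceCorrelation '' T) :
    Complex.ofReal '' (payoff G Γ '' (C ∩ synchronous n m)) =
      (fun τ => τ (gameElement G Γ)) '' T := by
  rw [hC, Set.image_image, Set.image_image]
  exact Set.image_congr fun τ hτ => (hT τ hτ).payoff_traceCorrelation G Γ

theorem isLUB_syncValue (hT : ∀ τ ∈ T, IsTracialState τ) (hne : T.Nonempty)
    (hC : C ∩ synchronous n m = traceCorrelation '' T) :
    IsLUB ((fun τ => τ (gameElement G Γ)) '' T) (syncValue C G Γ : ℂ) := by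
  have hV : (payoff G Γ '' (C ∩ synchronous n m)).Nonempty := by
    rw [hC]
    exact (hne.image _).image _
  have hbdd : BddAbove (payoff G Γ '' (C ∩ synchronous n m)) := by
    refine ⟨‖gameElement G Γ‖, ?_⟩
    rw [hC]
    rintro _ ⟨_, ⟨τ, hτ, rfl⟩, rfl⟩
    calc payoff G Γ (traceCorrelation τ) ≤ ‖(payoff G Γ (traceCorrelation τ) : ℂ)‖ := by
          rw [Complex.norm_real]
          exact le_abs_self _
      _ ≤ ‖gameElement G Γ‖ := by
          rw [(hT τ hτ).payoff_traceCorrelation]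
          exact norm_apply_le_of_map_one (hT τ hτ).map_one _
  rw [← ofReal_image_payoff G Γ hT hC]
  exact isLUB_image_ofReal hV (isLUB_csSup hV hbdd)

theorem isGreatest_syncValue (hT : ∀ τ ∈ T, IsTracialState τ) (hne : T.Nonempty)
    (hC : C ∩ synchronous n m = traceCorrelation '' T)
    (hcompact : IsCompact ((fun τ => τ (gameElement G Γ)) '' T)) :
    IsGreatest ((fun τ => τ (gameElement G Γ)) '' T) (syncValue C G Γ : ℂ) := by
  refine ⟨?_, (isLUB_syncValue G Γ hT hne hC).1⟩
  have himage := ofReal_image_payoff G Γ hT hC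
  have hV : IsCompact (payoff G Γ '' (C ∩ synchronous n m)) :=
    Complex.isometry_ofReal.isEmbedding.isCompact_iff.2 (himage ▸ hcompact)
  have hVne : (payoff G Γ '' (C ∩ synchronous n m)).Nonempty := by
    rw [hC]
    exact (hne.image _).image _
  rw [← himage]
  exact ⟨_, hV.sSup_mem hVne, rfl⟩

end Values

theorem exists_isTracialState_finiteDimensional_abelian (G : Type) [Group G] :
    ∃ τ : GroupCStar G →ₚ[ℂ] ℂ, IsTracialState τ ∧ HasFiniteDimensionalGNS τ ∧ HasAbelianGNS τ := by
  let π : GroupCStar G →⋆ₐ[ℂ] (ℂ →L[ℂ] ℂ) := GroupCStar.extend { H := ℂ, toHom := 1 }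
  have hcomm (S T : ℂ →L[ℂ] ℂ) : Commute S T := by
    refine ContinuousLinearMap.ext_ring ?_
    rw [mul_apply_eq_comp, mul_apply_eq_comp, ← mul_one (T 1), ← mul_one (S 1), ← smul_eq_mul,
      ← smul_eq_mul, map_smul, map_smul, smul_eq_mul, smul_eq_mul, mul_comm]
  refine ⟨vectorFunctional π 1, ⟨vectorFunctional_one π norm_one, fun a b => ?_⟩,
    hasFiniteDimensionalGNS_vectorFunctional π 1,
    hasAbelianGNS_vectorFunctional (fun a b => hcomm _ _) 1⟩
  rw [vectorFunctional_apply, vectorFunctional_apply, map_mul, map_mul, (hcomm _ _).eq]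

end

/-- Suprema of the values `τ(B)` are taken in the order of `ℂ` for which `z ≤ w` means that
`w - z` is real and nonnegative, so the statement includes that every `τ(B)` is real. -/
theorem proposition4p2 (n m : ℕ) [NeZero m] (G : Game n m) (Γ : InputDistribution n) :
    IsGreatest
      {z : ℂ | ∃ τ : GroupCStar (FreeProdCyclic n m) →ₚ[ℂ] ℂ,
        IsTracialState τ ∧ z = τ (gameElement G Γ)}
      (syncValue (Cqc n m) G Γ : ℂ) ∧
    IsLUB
      {z : ℂ | ∃ τ : GroupCStar (FreeProdCyclic n m) →ₚ[ℂ] ℂ,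
        IsTracialState τ ∧ HasFiniteDimensionalGNS τ ∧ z = τ (gameElement G Γ)}
      (syncValue (Cq n m) G Γ : ℂ) ∧
    IsGreatest
      {z : ℂ | ∃ τ : GroupCStar (FreeProdCyclic n m) →ₚ[ℂ] ℂ,
        IsTracialState τ ∧ HasAbelianGNS τ ∧ z = τ (gameElement G Γ)}
      (syncValue (Cloc n m) G Γ : ℂ) := by
  obtain ⟨τ₀, hτ₀, hfd, hab⟩ :=
    exists_isTracialState_finiteDimensional_abelian (FreeProdCyclic n m)
  have himage (Q : (GroupCStar (FreeProdCyclic n m) →ₚ[ℂ] ℂ) → Prop) :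
      {z : ℂ | ∃ τ, Q τ ∧ z = τ (gameElement G Γ)} =
        (fun τ => τ (gameElement G Γ)) '' {τ | Q τ} :=
    Set.ext fun z => exists_congr fun τ => and_congr_right' eq_comm
  simp only [← and_assoc, himage]
  refine ⟨⟨?_, ?_⟩, ?_⟩
  · exact isGreatest_syncValue G Γ (fun _ => id) ⟨τ₀, hτ₀⟩ Cqc_inter_synchronous
      (isCompact_image_isTracialState _)
  · exact isLUB_syncValue G Γ (fun _ => And.left) ⟨τ₀, hτ₀, hfd⟩ Cq_inter_synchronous
  · exact isGreatest_syncValue G Γ (fun _ => And.left) ⟨τ₀, hτ₀, hab⟩ Cloc_inter_synchronous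
      (isCompact_image_isTracialState_hasAbelianGNS _)
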